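/- For $k\ge 1$ let $P_k=\mathbb F_2[x_1,\dots,x_k]$ be the polynomial algebra with each $x_j$ of degree $1$, with the action of the mod-2 Steenrod algebra $\mathcal A$ given by the linear operations $Sq^i$ ($i\ge 0$) with $Sq^0(1)=1$, $Sq^i(1)=0$ for $i>0$, $Sq^0(x_j)=x_j$, $Sq^1(x_j)=x_j^2$, $Sq^i(x_j)=0$ for $i>1$, and the Cartan formula $Sq^n(fg)=\sum_{i=0}^n Sq^i(f)\,Sq^{n-i}(g)$. Let $\mathcal A^+P_k$ be the set of all finite sums of elements $Sq^i(f)$ with $i>0$ and $f\in P_k$, and let $QP_k=P_k/\mathcal A^+P_k=\mathbb F_2\otimes_{\mathcal A}P_k$. For $n\ge 0$ let $(QP_k)_n$ be the subspace of $QP_k$ of all classes represented by homogeneous polynomials of degree $n$; it is a finite-dimensional $\mathbb F_2$-vector space. Theorem. Let $k$ be an integer and let $d_1,\dots,d_{k-1}$ be positive integers with $d_1>d_2>\dots>d_{k-2}\ge d_{k-1}$. Put $$n=\sum_{i=1}^{k-1}(2^{d_i}-1),\qquad m=\sum_{i=1}^{k-2}(2^{d_i-d_{k-1}}-1).$$ If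 $d_{k-1}\ge k-1\ge 3$, then $$\dim_{\mathbb F_2}(QP_k)_n=(2^k-1)\,\dim_{\mathbb F_2}(QP_{k-1})_m .$$ -/

import Mathlib

/-- The polynomial algebra `P_k = 𝔽₂[x₁, …, x_k]`, each variable having degree `1`. -/
abbrev PolyAlg (k : ℕ) : Type := MvPolynomial (Fin k) (ZMod 2)

/-- The total Steenrod square `f ↦ ∑ i, Sq^i(f) t^i`, the algebra homomorphism `P_k → P_k[t]`
with `x_j ↦ x_j + x_j² t`. -/
noncomputable def totalSq (k : ℕ) : PolyAlg k →ₐ[ZMod 2] Polynomial (PolyAlg k) :=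
  MvPolynomial.aeval fun j =>
    Polynomial.C (MvPolynomial.X j) + Polynomial.C (MvPolynomial.X j ^ 2) * Polynomial.X

/-- The action on `P_k` of the Steenrod square `Sq^i`: the coefficient of `t^i` in the total
square. By `Sq_X` and `Sq_mul` below it has the prescribed values on the variables and satisfies
the Cartan formula; with linearity and the values on `1` this determines it. -/
noncomputable def Sq {k : ℕ} (i : ℕ) : PolyAlg k →ₗ[ZMod 2] PolyAlg k :=
  ((Polynomial.lcoeff (PolyAlg k) i).restrictScalars (ZMod 2)).comp (totalSq k).toLinearMap

theorem Sq_apply {k : ℕ} (i : ℕ) (f : PolyAlg k) : Sq i f = (totalSq k f).coeff i := rfl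

theorem Sq_X {k : ℕ} (i : ℕ) (j : Fin k) :
    Sq i (MvPolynomial.X j : PolyAlg k) =
      if i = 0 then MvPolynomial.X j else if i = 1 then MvPolynomial.X j ^ 2 else 0 := by
  rw [Sq_apply, totalSq, MvPolynomial.aeval_X, Polynomial.coeff_add, Polynomial.coeff_C,
    Polynomial.coeff_C_mul, Polynomial.coeff_X]
  rcases i with _ | _ | i <;> simp

theorem Sq_one {k : ℕ} (i : ℕ) : Sq i (1 : PolyAlg k) = if i = 0 then 1 else 0 := by
  rw [Sq_apply, map_one, Polynomial.coeff_one]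

/-- The Cartan formula. -/
theorem Sq_mul {k : ℕ} (n : ℕ) (f g : PolyAlg k) :
    Sq n (f * g) = ∑ i ∈ Finset.range (n + 1), Sq i f * Sq (n - i) g := by
  simp only [Sq_apply, map_mul, Polynomial.coeff_mul]
  exact Finset.Nat.sum_antidiagonal_eq_sum_range_succ
    (fun a b => (totalSq k f).coeff a * (totalSq k g).coeff b) n

/-- The space `𝒜⁺P_k` of hit polynomials: all finite sums of elements `Sq^i(f)` with `i > 0` and
`f ∈ P_k`. As the augmentation ideal `𝒜⁺` of the Steenrod algebra is generated by the `Sq^i` with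
`i > 0`, this is the action of `𝒜⁺` on `P_k`. -/
noncomputable def hit (k : ℕ) : Submodule (ZMod 2) (PolyAlg k) :=
  ⨆ (i : ℕ) (_ : 0 < i), LinearMap.range (Sq (k := k) i)

/-- The space of indecomposables `QP_k = P_k / 𝒜⁺P_k = 𝔽₂ ⊗_𝒜 P_k`. -/
abbrev QP (k : ℕ) : Type := PolyAlg k ⧸ hit k

/-- `(QP_k)_n`: the subspace of `QP_k` of all classes represented by homogeneous polynomials of
degree `n`. -/
noncomputable def QPdeg (k n : ℕ) : Submodule (ZMod 2) (QP k) :=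
  (MvPolynomial.homogeneousSubmodule (Fin k) (ZMod 2) n).map (hit k).mkQ

/-- `(QP_k)_n` is finite dimensional, so that `Module.finrank` is its dimension. -/
instance QPdeg_finite (k n : ℕ) : Module.Finite (ZMod 2) (QPdeg k n) := by
  have hf : {e : Fin k →₀ ℕ | e.degree = n}.Finite := by
    refine (Set.finite_Iic (Finsupp.equivFunOnFinite.symm fun _ : Fin k => n)).subset ?_
    intro e he i
    have he' : e.degree = n := he
    simpa [he'] using Finsupp.le_degree i e
  have hfin := FiniteDimensional.span_of_finite (ZMod 2)
    (hf.image fun e => (MvPolynomial.monomial e (1 : ZMod 2) : PolyAlg k))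
  have hle : MvPolynomial.homogeneousSubmodule (Fin k) (ZMod 2) n ≤
      Submodule.span (ZMod 2) ((fun e => (MvPolynomial.monomial e (1 : ZMod 2) : PolyAlg k)) ''
        {e : Fin k →₀ ℕ | e.degree = n}) := by
    intro f hfn
    rw [f.as_sum]
    refine Submodule.sum_mem _ fun e he => ?_
    have hmon : MvPolynomial.monomial e (f.coeff e) =
        f.coeff e • (MvPolynomial.monomial e (1 : ZMod 2) : PolyAlg k) := by
      rw [MvPolynomial.smul_monomial, smul_eq_mul, mul_one]
    rw [hmon]
    refine Submodule.smul_mem _ _ (Submodule.subset_span ⟨e, ?_, rfl⟩)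
    have hdeg := (MvPolynomial.mem_homogeneousSubmodule n f).1 hfn (MvPolynomial.mem_support_iff.1 he)
    have hw : e.degree = Finsupp.weight (1 : Fin k → ℕ) e :=
      DFunLike.congr_fun Finsupp.degree_eq_weight_one e
    exact hw.trans hdeg
  have h : Module.Finite (ZMod 2) (MvPolynomial.homogeneousSubmodule (Fin k) (ZMod 2) n) :=
    Submodule.finiteDimensional_of_le hle
  exact Module.Finite.map _ _

/-! Write q = k - 1 and d = d_q. The total square `sq` is a ring map, and being hit in one degree N
is membership in the span of all `sq f - f` and all polynomials without terms of degree N. Thus only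
identities for `sq` are needed.

Put N_t = ∑ (2^(d_i - t) - 1), so that N_t = 2 N_{t+1} + q, N_0 = n and N_d = m. A digit sum count
and Wood's argument (`good_of_ne`) show that for t < d a monomial of degree N_t with at most k - 2
odd exponents is hit. By parity it cannot have k odd exponents. Hence modulo hits only the images of
the maps lift_j : y ↦ (∏_{i≠j} x_i) y² remain. These preserve hits and satisfy ∑_j lift_j(x_j g) ≡
0. From this relation, lifts commute, and lift_a lift_a lift_b ≡ lift_b lift_b lift_a. So a d-fold
lift depends only on the set S of its indices, and degree n is spanned by elements e_S(y), with y of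
degree m, subject to ∑_j e_{T∪j}(x_j u) ≡ 0 for |T| < d.

Each nonempty L ⊆ {1, …, k} gives a linear form ℓ_L = ∑_{j∈L} x_j. Restriction to ℓ_L = 0 followed
by d Kameko maps sends e_S(y) to the restriction of y if S ⊆ L, and to 0 otherwise
(`kameko_pow_proj_setLift`). These 2^k - 1 maps together give the isomorphism from (QP_k)_n to
copies of (QP_{k-1})_m. For injectivity, if all images of ∑ e_S(y_S) are hit, then each ∑_{S⊆L} y_S
is a multiple ℓ_L u_L modulo hits. Möbius inversion over subsets modulo 2 turns the sum into a
combination of the relations (`Chain.sum_setLift_mem`). If d = k - 1 the relations with |T| = k - 1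
are missing, and `exists_section` replaces them. Surjectivity is Möbius inversion again
(`range_descentPi`). -/

namespace HitProblem

open MvPolynomial

/-! ### Degrees of monomials and the ungraded total square -/

/-- The polynomials all of whose monomials have degree in `A`. -/
noncomputable def degIn (k : ℕ) (A : Set ℕ) : Submodule (ZMod 2) (PolyAlg k) where
  carrier := {f | ∀ e, coeff e f ≠ 0 → e.degree ∈ A}
  zero_mem' := by intro e he; simp at he
  add_mem' := by
    intro f g hf hg e he
    by_cases h : coeff e f = 0
    · exact hg e (by simpa [h] using he)
    · exact hf e h
  smul_mem' := by
    intro c f hf e he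
    exact hf e (fun h => he (by simp [h]))

variable {k : ℕ}

theorem degIn_mono {A B : Set ℕ} (h : A ⊆ B) : degIn k A ≤ degIn k B :=
  fun _ hf e he => h (hf e he)

theorem mem_degIn_univ (f : PolyAlg k) : f ∈ degIn k Set.univ := fun _ _ => trivial

theorem monomial_mem_degIn {A : Set ℕ} {e : Fin k →₀ ℕ} (c : ZMod 2) (h : e.degree ∈ A) :
    monomial e c ∈ degIn k A := by
  intro e' he'
  rw [coeff_monomial] at he'
  by_cases h' : e = e'
  · exact h' ▸ h
  · simp [h'] at he'

theorem X_mem_degIn (j : Fin k) : (X j : PolyAlg k) ∈ degIn k {1} :=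
  monomial_mem_degIn 1 (by simp)

theorem one_mem_degIn : (1 : PolyAlg k) ∈ degIn k {0} :=
  monomial_mem_degIn (e := 0) 1 (by simp)

theorem mul_mem_degIn {A B C : Set ℕ} {f g : PolyAlg k} (hf : f ∈ degIn k A)
    (hg : g ∈ degIn k B) (h : ∀ a ∈ A, ∀ b ∈ B, a + b ∈ C) : f * g ∈ degIn k C := by
  intro e he
  rw [coeff_mul] at he
  obtain ⟨x, hx, hne⟩ := Finset.exists_ne_zero_of_sum_ne_zero he
  have hx' := Finset.HasAntidiagonal.mem_antidiagonal.1 hx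
  rw [← hx', map_add]
  exact h _ (hf _ (left_ne_zero_of_mul hne)) _ (hg _ (right_ne_zero_of_mul hne))

/-- A linear map is controlled on `degIn k A` by its values on monomials. -/
theorem map_mem_of_degIn {M : Type*} [AddCommGroup M] [Module (ZMod 2) M]
    (φ : PolyAlg k →ₗ[ZMod 2] M) (W : Submodule (ZMod 2) M) {A : Set ℕ}
    (h : ∀ e : Fin k →₀ ℕ, e.degree ∈ A → φ (monomial e 1) ∈ W) {f : PolyAlg k}
    (hf : f ∈ degIn k A) : φ f ∈ W := by
  rw [f.as_sum, map_sum]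
  refine Submodule.sum_mem _ fun e he => ?_
  have : monomial e (coeff e f) = coeff e f • (monomial e 1 : PolyAlg k) := by
    rw [smul_monomial, smul_eq_mul, mul_one]
  rw [this, map_smul]
  exact W.smul_mem _ (h e (hf e (mem_support_iff.1 he)))

theorem map_mem_of_monomial {M : Type*} [AddCommGroup M] [Module (ZMod 2) M]
    (φ : PolyAlg k →ₗ[ZMod 2] M) (W : Submodule (ZMod 2) M)
    (h : ∀ e : Fin k →₀ ℕ, φ (monomial e 1) ∈ W) (f : PolyAlg k) : φ f ∈ W :=
  map_mem_of_degIn φ W (fun e _ => h e) (mem_degIn_univ f)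

theorem exponent_induction {Q : (Fin k →₀ ℕ) → Prop} (h0 : Q 0)
    (hs : ∀ e j, Q e → Q (Finsupp.single j 1 + e)) (e : Fin k →₀ ℕ) : Q e := by
  induction h : e.degree generalizing e with
  | zero => rwa [(Finsupp.degree_eq_zero_iff e).1 h]
  | succ n ih =>
    have hne : e ≠ 0 := by rintro rfl; simp at h
    obtain ⟨j, hj⟩ := Finsupp.ne_iff.1 hne
    have hle : Finsupp.single j 1 ≤ e := by
      rw [Finsupp.single_le_iff]; exact Nat.one_le_iff_ne_zero.2 hj
    have he : Finsupp.single j 1 + (e - Finsupp.single j 1) = e := add_tsub_cancel_of_le hle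
    have hd := congrArg Finsupp.degree he
    rw [map_add, Finsupp.degree_single, h] at hd
    rw [← he]
    exact hs _ _ (ih _ (by omega))

theorem monomial_single_add (e : Fin k →₀ ℕ) (j : Fin k) :
    (monomial (Finsupp.single j 1 + e) 1 : PolyAlg k) = X j * monomial e 1 := by
  rw [X, monomial_mul, one_mul]

/-- The ungraded total square, `x_j ↦ x_j + x_j²`. -/
noncomputable def sq (k : ℕ) : PolyAlg k →ₐ[ZMod 2] PolyAlg k :=
  aeval fun j => X j + X j ^ 2

@[simp] theorem sq_X (j : Fin k) : sq k (X j) = X j + X j ^ 2 := by simp [sq]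

theorem sq_monomial_sub_self (e : Fin k →₀ ℕ) :
    sq k (monomial e 1) - monomial e 1 ∈ degIn k (Set.Ioi e.degree) := by
  induction e using exponent_induction with
  | h0 =>
    have : (monomial 0 1 : PolyAlg k) = 1 := rfl
    rw [this, map_one, sub_self]
    exact zero_mem _
  | hs e j ih =>
    have hS : sq k (monomial e 1) ∈ degIn k (Set.Ici e.degree) := by
      have := add_mem (degIn_mono Set.Ioi_subset_Ici_self ih)
        (monomial_mem_degIn (A := Set.Ici e.degree) (e := e) 1 (Set.mem_Ici.2 le_rfl))
      simpa using this
    rw [monomial_single_add, map_mul, sq_X, map_add, Finsupp.degree_single]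
    have : (X j + X j ^ 2) * sq k (monomial e 1) - X j * monomial e 1 =
        X j * (sq k (monomial e 1) - monomial e 1) + X j * (X j * sq k (monomial e 1)) := by ring
    rw [this]
    refine add_mem (mul_mem_degIn (X_mem_degIn j) ih ?_)
      (mul_mem_degIn (X_mem_degIn j) (mul_mem_degIn (C := Set.Ioi e.degree) (X_mem_degIn j) hS ?_) ?_)
    all_goals
      simp only [Set.mem_singleton_iff, Set.mem_Ioi, Set.mem_Ici]
      intros; omega

theorem monomial_sq (e : Fin k →₀ ℕ) :
    (monomial e 1 : PolyAlg k) ^ 2 = monomial (2 • e) 1 := by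
  rw [monomial_pow, one_pow]

theorem sq_monomial_sub_sq (e : Fin k →₀ ℕ) :
    sq k (monomial e 1) - monomial e 1 ^ 2 ∈ degIn k (Set.Iio (2 * e.degree)) := by
  induction e using exponent_induction with
  | h0 =>
    have : (monomial 0 1 : PolyAlg k) = 1 := rfl
    rw [this, map_one, one_pow, sub_self]
    exact zero_mem _
  | hs e j ih =>
    have hS : sq k (monomial e 1) ∈ degIn k (Set.Iic (2 * e.degree)) := by
      have h2 : (monomial e 1 : PolyAlg k) ^ 2 ∈ degIn k (Set.Iic (2 * e.degree)) := by
        rw [monomial_sq]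
        exact monomial_mem_degIn 1 (by simp)
      have := add_mem (degIn_mono Set.Iio_subset_Iic_self ih) h2
      simpa using this
    rw [monomial_single_add, map_mul, sq_X, map_add, Finsupp.degree_single]
    have : (X j + X j ^ 2) * sq k (monomial e 1) - (X j * monomial e 1) ^ 2 =
        X j * sq k (monomial e 1) +
          X j * (X j * (sq k (monomial e 1) - monomial e 1 ^ 2)) := by ring
    rw [this]
    refine add_mem (mul_mem_degIn (X_mem_degIn j) hS ?_)
      (mul_mem_degIn (X_mem_degIn j)
        (mul_mem_degIn (C := Set.Iio (2 * e.degree + 1)) (X_mem_degIn j) ih ?_) ?_)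
    all_goals
      simp only [Set.mem_singleton_iff, Set.mem_Iio, Set.mem_Iic]
      intros; omega

/-! ### Hit polynomials in a single degree -/

/-- The polynomials whose component of degree `N` is hit, see `mem_hitIn_iff`. -/
noncomputable def hitIn (k N : ℕ) : Submodule (ZMod 2) (PolyAlg k) :=
  LinearMap.range ((sq k).toLinearMap - LinearMap.id) ⊔ degIn k {N}ᶜ

theorem sq_sub_mem_hitIn (N : ℕ) (f : PolyAlg k) : sq k f - f ∈ hitIn k N :=
  Submodule.mem_sup_left ⟨f, rfl⟩

theorem degIn_le_hitIn {N : ℕ} {A : Set ℕ} (h : N ∉ A) : degIn k A ≤ hitIn k N :=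
  (degIn_mono (Set.subset_compl_singleton_iff.2 h)).trans le_sup_right

theorem hitIn_le {N : ℕ} {W : Submodule (ZMod 2) (PolyAlg k)}
    (h1 : ∀ f, sq k f - f ∈ W) (h2 : degIn k {N}ᶜ ≤ W) : hitIn k N ≤ W := by
  refine sup_le ?_ h2
  rintro _ ⟨f, rfl⟩
  exact h1 f

theorem map_mem_of_hitIn {M : Type*} [AddCommGroup M] [Module (ZMod 2) M]
    (φ : PolyAlg k →ₗ[ZMod 2] M) (W : Submodule (ZMod 2) M) {N : ℕ}
    (h1 : ∀ f, φ (sq k f - f) ∈ W)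
    (h2 : ∀ e : Fin k →₀ ℕ, e.degree ≠ N → φ (monomial e 1) ∈ W)
    {f : PolyAlg k} (hf : f ∈ hitIn k N) : φ f ∈ W :=
  hitIn_le (W := W.comap φ) h1 (fun _ hg => map_mem_of_degIn φ W (fun e he => h2 e he) hg) hf

/-- A linear map which sees only one degree may be tested on the image of `sq`. -/
theorem map_mem_of_sq {M : Type*} [AddCommGroup M] [Module (ZMod 2) M]
    (φ : PolyAlg k →ₗ[ZMod 2] M) (W : Submodule (ZMod 2) M) (h : ℕ)
    (h1 : ∀ e : Fin k →₀ ℕ, e.degree ≠ h → φ (monomial e 1) ∈ W)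
    (h2 : ∀ g, φ (sq k g) ∈ W) (g : PolyAlg k) : φ g ∈ W := by
  refine map_mem_of_monomial φ W (fun e => ?_) g
  by_cases he : e.degree = h
  -- A monomial differs from its total square only in higher degrees, where `φ` already lands in
  -- `W`.
  · have h3 : φ (sq k (monomial e 1) - monomial e 1) ∈ W :=
      map_mem_of_degIn φ W (A := Set.Ioi e.degree)
        (fun e' he' => h1 e' (by rw [Set.mem_Ioi] at he'; omega)) (sq_monomial_sub_self e)
    have := sub_mem (h2 (monomial e 1)) h3
    rwa [← map_sub, sub_sub_cancel] at this
  · exact h1 e he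

theorem Sq_X_mul (i : ℕ) (j : Fin k) (f : PolyAlg k) :
    Sq (i + 1) (X j * f) = X j * Sq (i + 1) f + X j ^ 2 * Sq i f := by
  rw [Sq_apply, map_mul, totalSq, aeval_X, add_mul, Polynomial.coeff_add, Polynomial.coeff_C_mul,
    mul_assoc, Polynomial.coeff_C_mul, Polynomial.coeff_X_mul]
  rfl

theorem Sq_zero_X_mul (j : Fin k) (f : PolyAlg k) : Sq 0 (X j * f) = X j * Sq 0 f := by
  rw [Sq_apply, map_mul, Polynomial.mul_coeff_zero]
  congr 1
  rw [← Sq_apply, Sq_X, if_pos rfl]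

theorem Sq_monomial_mem (i : ℕ) (e : Fin k →₀ ℕ) :
    Sq i (monomial e 1 : PolyAlg k) ∈ degIn k {e.degree + i} := by
  induction e using exponent_induction generalizing i with
  | h0 =>
    have : (monomial 0 1 : PolyAlg k) = 1 := rfl
    rw [this, Sq_one]
    split_ifs with h
    · subst h; exact one_mem_degIn
    · exact zero_mem _
  | hs e j ih =>
    rw [monomial_single_add, map_add, Finsupp.degree_single]
    cases i with
    | zero =>
      rw [Sq_zero_X_mul]
      refine mul_mem_degIn (X_mem_degIn j) (ih 0) ?_
      simp
    | succ i =>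
      rw [Sq_X_mul, pow_two, mul_assoc]
      refine add_mem (mul_mem_degIn (X_mem_degIn j) (ih (i + 1)) ?_)
        (mul_mem_degIn (X_mem_degIn j)
          (mul_mem_degIn (C := {e.degree + i + 1}) (X_mem_degIn j) (ih i) ?_) ?_)
      all_goals
        simp only [Set.mem_singleton_iff]
        intros; omega

theorem sq_eq_sum_Sq (f : PolyAlg k) :
    sq k f = ∑ i ∈ Finset.range ((totalSq k f).natDegree + 1), Sq i f := by
  have h : (Polynomial.evalRingHom (1 : PolyAlg k)).comp (totalSq k).toRingHom =
      (sq k).toRingHom := by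
    refine MvPolynomial.ringHom_ext (fun r => ?_) fun j => ?_
    · have h1 : (C r : PolyAlg k) = algebraMap (ZMod 2) _ r := rfl
      simp only [RingHom.coe_comp, Function.comp_apply, AlgHom.toRingHom_eq_coe,
        RingHom.coe_coe, h1, AlgHom.commutes]
      rw [IsScalarTower.algebraMap_apply (ZMod 2) (PolyAlg k) (Polynomial (PolyAlg k)),
        Polynomial.algebraMap_eq, Polynomial.coe_evalRingHom, Polynomial.eval_C]
    · simp [totalSq, sq]
  have h1 : sq k f = Polynomial.eval 1 (totalSq k f) := (RingHom.congr_fun h f).symm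
  rw [h1, Polynomial.eval_eq_sum_range]
  simp [Sq_apply]

theorem Sq_zero (f : PolyAlg k) : Sq 0 f = f := by
  have h := map_mem_of_monomial (Sq 0 - LinearMap.id) (⊥ : Submodule (ZMod 2) (PolyAlg k)) (k := k)
    (fun e => ?_) f
  · rw [Submodule.mem_bot, LinearMap.sub_apply, sub_eq_zero] at h
    exact h
  · rw [Submodule.mem_bot, LinearMap.sub_apply, sub_eq_zero, LinearMap.id_apply]
    induction e using exponent_induction with
    | h0 => exact (Sq_one 0).trans (if_pos rfl)
    | hs e j ih => rw [monomial_single_add, Sq_zero_X_mul, ih]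

theorem Sq_mem_hit {i : ℕ} (hi : 0 < i) (f : PolyAlg k) : Sq i f ∈ hit k :=
  Submodule.mem_iSup_of_mem i (Submodule.mem_iSup_of_mem hi ⟨f, rfl⟩)

theorem sq_sub_mem_hit (f : PolyAlg k) : sq k f - f ∈ hit k := by
  rw [sq_eq_sum_Sq, Finset.sum_range_succ', Sq_zero, add_sub_cancel_right]
  exact Submodule.sum_mem _ fun i _ => Sq_mem_hit (Nat.succ_pos i) f

theorem sub_homogeneousComponent_mem (n : ℕ) (f : PolyAlg k) :
    f - homogeneousComponent n f ∈ degIn k {n}ᶜ := by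
  intro e he h
  rw [Set.mem_singleton_iff] at h
  rw [coeff_sub, coeff_homogeneousComponent, if_pos h, sub_self] at he
  exact he rfl

theorem homogeneousComponent_of_mem {n : ℕ} {f : PolyAlg k} (hf : f ∈ degIn k {n}) :
    homogeneousComponent n f = f := by
  ext e
  rw [coeff_homogeneousComponent]
  split_ifs with h
  · rfl
  · by_contra h'
    exact h (hf e (Ne.symm h'))

theorem homogeneousComponent_of_notMem {n : ℕ} {A : Set ℕ} {f : PolyAlg k} (hf : f ∈ degIn k A)
    (hn : n ∉ A) : homogeneousComponent n f = 0 := by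
  ext e
  rw [coeff_homogeneousComponent]
  split_ifs with h
  · by_contra h'
    exact hn (h ▸ hf e h')
  · rfl

theorem homogeneousComponent_mem_hit {n : ℕ} {f : PolyAlg k} (hf : f ∈ hit k) :
    homogeneousComponent n f ∈ hit k := by
  suffices h : hit k ≤ (hit k).comap (homogeneousComponent n) from h hf
  refine iSup_le fun i => iSup_le fun hi => ?_
  rintro _ ⟨g, rfl⟩
  refine map_mem_of_monomial ((homogeneousComponent n).comp (Sq i)) (hit k) (fun e => ?_) g
  rw [LinearMap.comp_apply]
  have h := Sq_monomial_mem i e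
  by_cases hn : e.degree + i = n
  · rw [homogeneousComponent_of_mem (hn ▸ h)]
    exact Sq_mem_hit hi _
  · rw [homogeneousComponent_of_notMem h fun h' => hn h'.symm]
    exact zero_mem _

/-- The terms Sq^j of a monomial lie in distinct degrees. If Sq^i lands in degree n, all other terms
of the total square are invisible there, so Sq^i agrees with `sq - id` up to other degrees. -/
theorem hit_le_hitIn (n : ℕ) : hit k ≤ hitIn k n := by
  refine iSup_le fun i => iSup_le fun hi => ?_
  rintro _ ⟨g, rfl⟩
  refine map_mem_of_monomial (Sq i) (hitIn k n) (fun e => ?_) g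
  have h := Sq_monomial_mem i e
  by_cases hn : e.degree + i = n
  · have h1 : sq k (monomial e 1) - Sq i (monomial e 1) ∈ hitIn k n := by
      have h2 : sq k (monomial e 1) = ∑ j ∈ Finset.range ((totalSq k (monomial e 1)).natDegree + 1),
        Sq j (monomial e 1 : PolyAlg k) := sq_eq_sum_Sq _
      by_cases hm : i ∈ Finset.range ((totalSq k (monomial e 1)).natDegree + 1)
      · rw [h2, ← Finset.add_sum_erase _ _ hm, add_sub_cancel_left]
        refine Submodule.sum_mem _ fun j hj => degIn_le_hitIn ?_ (Sq_monomial_mem j e)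
        have := Finset.ne_of_mem_erase hj
        rw [Set.mem_singleton_iff]
        omega
      · have h3 : Sq i (monomial e 1 : PolyAlg k) = 0 := by
          rw [Sq_apply]
          refine Polynomial.coeff_eq_zero_of_natDegree_lt ?_
          simpa using hm
        rw [h3, sub_zero, h2]
        refine Submodule.sum_mem _ fun j hj => degIn_le_hitIn ?_ (Sq_monomial_mem j e)
        have : j ≠ i := fun h => hm (h ▸ hj)
        rw [Set.mem_singleton_iff]
        omega
    have h4 : monomial e (1 : ZMod 2) ∈ hitIn k n :=
      degIn_le_hitIn (A := {e.degree}) (by rw [Set.mem_singleton_iff]; omega)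
        (monomial_mem_degIn 1 rfl)
    have h5 := sub_mem (add_mem (sq_sub_mem_hitIn n (monomial e 1)) h4) h1
    rwa [sub_add_cancel, sub_sub_cancel] at h5
  · exact degIn_le_hitIn (fun h' => hn h'.symm) h

theorem mem_hitIn_iff {n : ℕ} {f : PolyAlg k} :
    f ∈ hitIn k n ↔ homogeneousComponent n f ∈ hit k := by
  constructor
  · intro hf
    refine hitIn_le (W := (hit k).comap (homogeneousComponent n))
      (fun g => homogeneousComponent_mem_hit (sq_sub_mem_hit g)) (fun g hg => ?_) hf
    rw [Submodule.mem_comap, homogeneousComponent_of_notMem hg (by simp)]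
    exact zero_mem _
  · intro hf
    have := add_mem (degIn_le_hitIn (by simp) (sub_homogeneousComponent_mem n f))
      (hit_le_hitIn n hf)
    rwa [sub_add_cancel] at this

theorem range_mkQ_comp_homogeneousComponent (k n : ℕ) :
    LinearMap.range ((hit k).mkQ.comp (homogeneousComponent n)) = QPdeg k n := by
  rw [LinearMap.range_comp, QPdeg]
  congr 1
  ext f
  constructor
  · rintro ⟨g, rfl⟩
    exact homogeneousComponent_isHomogeneous n g
  · intro hf
    exact ⟨f, by
      rw [homogeneousComponent_of_mem]
      intro e he
      have h := (mem_homogeneousSubmodule n f).1 hf he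
      have hw : e.degree = Finsupp.weight (1 : Fin k → ℕ) e :=
        DFunLike.congr_fun Finsupp.degree_eq_weight_one e
      exact hw.trans h⟩

/-- `(QP_k)_n` as a quotient of `P_k`. -/
noncomputable def quotHitInEquiv (k n : ℕ) :
    (PolyAlg k ⧸ hitIn k n) ≃ₗ[ZMod 2] QPdeg k n :=
  (Submodule.quotEquivOfEq _ _ (by
    ext f
    rw [LinearMap.mem_ker, LinearMap.comp_apply, Submodule.mkQ_apply,
      Submodule.Quotient.mk_eq_zero, mem_hitIn_iff])).trans
    ((((hit k).mkQ.comp (homogeneousComponent n)).quotKerEquivRange).trans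
      (LinearEquiv.ofEq _ _ (range_mkQ_comp_homogeneousComponent k n)))

instance finite_quotHitIn (k n : ℕ) : Module.Finite (ZMod 2) (PolyAlg k ⧸ hitIn k n) :=
  Module.Finite.equiv (quotHitInEquiv k n).symm

end HitProblem

/-! ### Odd exponents and Wood's criterion -/

namespace HitProblem

open MvPolynomial

variable {k : ℕ}

/-- The squarefree monomial with support `s`. -/
noncomputable def xs (s : Finset (Fin k)) : PolyAlg k := ∏ j ∈ s, X j

theorem xs_mem_degIn (s : Finset (Fin k)) : xs s ∈ degIn k {s.card} := by
  induction s using Finset.induction_on with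
  | empty => exact one_mem_degIn
  | insert j s hj ih =>
    rw [xs, Finset.prod_insert hj, Finset.card_insert_of_notMem hj]
    refine mul_mem_degIn (X_mem_degIn j) ih ?_
    simp only [Set.mem_singleton_iff]
    intros; omega

theorem X_mul_xs_erase {s : Finset (Fin k)} {j : Fin k} (hj : j ∈ s) :
    X j * xs (s.erase j) = xs s := Finset.mul_prod_erase s _ hj

theorem X_mul_xs {s : Finset (Fin k)} {j : Fin k} (hj : j ∈ s) :
    X j * xs s = xs (s.erase j) * X j ^ 2 := by
  rw [← X_mul_xs_erase hj]; ring

/-- The linear map `y ↦ f y²`. -/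
noncomputable def mulSq (f : PolyAlg k) : PolyAlg k →ₗ[ZMod 2] PolyAlg k :=
  (LinearMap.mulLeft (ZMod 2) f).comp
    ((frobenius (PolyAlg k) 2).toAddMonoidHom.toZModLinearMap 2)

@[simp] theorem mulSq_apply (f y : PolyAlg k) : mulSq f y = f * y ^ 2 := rfl

theorem mulSq_xs_monomial_mem (s : Finset (Fin k)) (e : Fin k →₀ ℕ) :
    mulSq (xs s) (monomial e 1) ∈ degIn k {s.card + 2 * e.degree} := by
  rw [mulSq_apply, monomial_sq]
  refine mul_mem_degIn (xs_mem_degIn s)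
    (monomial_mem_degIn (A := {2 * e.degree}) 1 (by simp)) ?_
  simp only [Set.mem_singleton_iff]
  intros; omega

/-- Every monomial is a squarefree monomial times a square. -/
theorem monomial_eq_mulSq (e : Fin k →₀ ℕ) :
    ∃ (s : Finset (Fin k)) (e' : Fin k →₀ ℕ),
      (monomial e 1 : PolyAlg k) = mulSq (xs s) (monomial e' 1) := by
  induction e using exponent_induction with
  | h0 => exact ⟨∅, 0, by simp [xs]⟩
  | hs e j ih =>
    obtain ⟨s, e', h⟩ := ih
    rw [monomial_single_add, h]
    by_cases hj : j ∈ s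
    · refine ⟨s.erase j, Finsupp.single j 1 + e', ?_⟩
      rw [monomial_single_add, mulSq_apply, mulSq_apply, ← mul_assoc, X_mul_xs hj]
      ring
    · refine ⟨insert j s, e', ?_⟩
      rw [mulSq_apply, mulSq_apply, ← mul_assoc, xs, xs, Finset.prod_insert hj]

/-- In degree `N`, all monomials with at most `k - 2` odd exponents are hit. -/
def Good (k N : ℕ) : Prop :=
  ∀ s : Finset (Fin k), s.card + 1 < k → ∀ y, mulSq (xs s) y ∈ hitIn k N

/-- The power sum `∑ x^(2^a)` for `a < A`. -/
noncomputable def twoPowSum (A : ℕ) (j : Fin k) : PolyAlg k := ∑ a ∈ Finset.range A, X j ^ 2 ^ a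

theorem add_self_eq_zero' {M : Type*} [AddCommGroup M] [Module (ZMod 2) M] (x : M) :
    x + x = 0 := by
  rw [← two_smul (ZMod 2) x, show (2 : ZMod 2) = 0 from rfl, zero_smul]

theorem eq_of_add_eq_zero' {M : Type*} [AddCommGroup M] [Module (ZMod 2) M] {x y : M}
    (h : x + y = 0) : x = y := by
  rw [← add_self_eq_zero' y] at h
  exact add_right_cancel h

/-- The sum telescopes modulo 2. Up to a term of arbitrarily high degree, `twoPowSum` is thus a
preimage of the variable under `sq`. -/
theorem sq_twoPowSum (A : ℕ) (j : Fin k) :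
    sq k (twoPowSum A j) = X j + X j ^ 2 ^ A := by
  induction A with
  | zero => simp [twoPowSum, add_self_eq_zero']
  | succ A ih =>
    rw [twoPowSum, Finset.sum_range_succ, map_add, ← twoPowSum, ih, map_pow, sq_X,
      add_pow_char_pow, ← pow_mul, ← pow_succ', add_assoc, ← add_assoc (X j ^ 2 ^ A),
      add_self_eq_zero', zero_add]

theorem X_pow_mem_degIn (j : Fin k) (a : ℕ) : (X j ^ a : PolyAlg k) ∈ degIn k {a} := by
  rw [X_pow_eq_monomial]
  exact monomial_mem_degIn 1 (by simp)

theorem prod_twoPowSum_mem (A : ℕ) (s : Finset (Fin k)) :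
    ∏ j ∈ s, twoPowSum A j ∈ degIn k {D | ∃ a : Fin k → ℕ, D = ∑ j ∈ s, 2 ^ a j} := by
  induction s using Finset.induction_on with
  | empty => exact degIn_mono (by simp) one_mem_degIn
  | insert j s hj ih =>
    rw [Finset.prod_insert hj]
    refine mul_mem_degIn (A := {D | ∃ b, D = 2 ^ b}) ?_ ih ?_
    · exact Submodule.sum_mem _ fun a _ => degIn_mono (by simp) (X_pow_mem_degIn j (2 ^ a))
    · rintro _ ⟨b, rfl⟩ _ ⟨a, rfl⟩
      refine ⟨Function.update a j b, ?_⟩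
      rw [Finset.sum_insert hj, Function.update_self]
      congr 1
      refine Finset.sum_congr rfl fun i hi => ?_
      rw [Function.update_of_ne]
      rintro rfl
      exact hj hi

theorem prod_X_add_X_pow_sub_mem (B : ℕ) (s : Finset (Fin k)) :
    ∏ j ∈ s, (X j + X j ^ B) - xs s ∈ degIn k (Set.Ici B) := by
  induction s using Finset.induction_on with
  | empty => simp [xs]
  | insert j s hj ih =>
    rw [xs, Finset.prod_insert hj, Finset.prod_insert hj, ← xs]
    have : (X j + X j ^ B) * ∏ i ∈ s, (X i + X i ^ B) - X j * xs s =
      X j * (∏ i ∈ s, (X i + X i ^ B) - xs s) + X j ^ B * ∏ i ∈ s, (X i + X i ^ B) := by ring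
    rw [this]
    refine add_mem (mul_mem_degIn (mem_degIn_univ _) ih ?_)
      (mul_mem_degIn (X_pow_mem_degIn j B) (mem_degIn_univ _) ?_)
    all_goals
      simp only [Set.mem_singleton_iff, Set.mem_Ici]
      intros; omega

/-- A form of Wood's theorem: a squarefree monomial of degree `q` times `y²` is hit
if `q + deg y` is not a sum of `q` powers of two. -/
theorem good_of_ne {N : ℕ} (hN : ∀ s : Finset (Fin k), s.card + 1 < k → ∀ a : Fin k → ℕ,
    ∑ j ∈ s, 2 ^ (a j + 1) ≠ N + s.card) : Good k N := by
  intro s hs y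
  refine map_mem_of_monomial _ _ (fun e => ?_) y
  by_cases hd : s.card + 2 * e.degree = N
  swap
  · exact degIn_le_hitIn (by rw [Set.mem_singleton_iff]; omega) (mulSq_xs_monomial_mem s e)
  -- This product F is chosen so that, in degree N, its total square is the squarefree monomial
  -- times the square of `monomial e 1`. F itself has no term of degree N: such a term would need ∑
  -- 2^(a_j) + deg e = N, which after doubling is excluded by `hN`.
  have hF : (∏ j ∈ s, twoPowSum N j) * monomial e 1 ∈ hitIn k N := by
    have h1 : (∏ j ∈ s, twoPowSum N j) * monomial e 1 ∈ degIn k {N}ᶜ := by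
      refine mul_mem_degIn (prod_twoPowSum_mem N s)
        (monomial_mem_degIn (A := {e.degree}) 1 rfl) ?_
      rintro _ ⟨a, rfl⟩ _ rfl h
      rw [Set.mem_singleton_iff] at h
      refine hN s hs a ?_
      simp_rw [pow_succ]
      rw [← Finset.sum_mul]
      omega
    exact degIn_le_hitIn (by simp) h1
  have h1 := add_mem (sq_sub_mem_hitIn N ((∏ j ∈ s, twoPowSum N j) * monomial e 1)) hF
  rw [sub_add_cancel, map_mul, map_prod] at h1
  simp_rw [sq_twoPowSum] at h1
  -- The cutoff A = N suffices because 2^N > N.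
  have h2 : (∏ j ∈ s, (X j + X j ^ 2 ^ N) - xs s) * sq k (monomial e 1) ∈ hitIn k N := by
    refine degIn_le_hitIn (A := Set.Ici (2 ^ N)) ?_
      (mul_mem_degIn (prod_X_add_X_pow_sub_mem _ s) (mem_degIn_univ _) ?_)
    · have := Nat.lt_two_pow_self (n := N)
      rw [Set.mem_Ici]; omega
    · simp only [Set.mem_Ici]
      intros; omega
  have h3 : xs s * (sq k (monomial e 1) - monomial e 1 ^ 2) ∈ hitIn k N := by
    refine degIn_le_hitIn (A := Set.Iio N) (by simp)
      (mul_mem_degIn (xs_mem_degIn s) (sq_monomial_sub_sq e) ?_)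
    simp only [Set.mem_singleton_iff, Set.mem_Iio]
    intros; omega
  have h4 := sub_mem (sub_mem h1 h2) h3
  have : (∏ j ∈ s, (X j + X j ^ 2 ^ N)) * sq k (monomial e 1) -
      (∏ j ∈ s, (X j + X j ^ 2 ^ N) - xs s) * sq k (monomial e 1) -
      xs s * (sq k (monomial e 1) - monomial e 1 ^ 2) = xs s * monomial e 1 ^ 2 := by ring
  rwa [this] at h4

/-- Expand ∏ (x_j + x_j²): the set t collects the variables keeping an odd exponent, and the others
move under the square. -/
theorem sq_mulSq_xs (s : Finset (Fin k)) (g : PolyAlg k) :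
    sq k (mulSq (xs s) g) = ∑ t ∈ s.powerset, mulSq (xs t) (xs (s \ t) * sq k g) := by
  rw [mulSq_apply, map_mul, map_pow, xs, map_prod]
  simp_rw [sq_X]
  rw [Finset.prod_add, Finset.sum_mul]
  refine Finset.sum_congr rfl fun t _ => ?_
  rw [mulSq_apply, mul_pow, xs, xs, Finset.prod_pow]
  ring

/-! ### One step down in degree: the maps omitting a variable -/

/-- `N = 2 N' + (k - 1)`, and the monomials of degree `N` with few odd exponents are hit. -/
structure Step (k N N' : ℕ) : Prop where
  eq : N + 1 = 2 * N' + k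
  good : Good k N

/-- The map `y ↦ x₁ ⋯ x̂_j ⋯ x_k y²`. -/
noncomputable def lift (j : Fin k) : PolyAlg k →ₗ[ZMod 2] PolyAlg k :=
  mulSq (xs (Finset.univ.erase j))

theorem lift_apply (j : Fin k) (y : PolyAlg k) : lift j y = xs (Finset.univ.erase j) * y ^ 2 := rfl

variable {N N' : ℕ}

theorem Step.univ_mem (h : Step k N N') (y : PolyAlg k) :
    mulSq (xs Finset.univ) y ∈ hitIn k N := by
  refine map_mem_of_monomial _ _ (fun e => ?_) y
  refine degIn_le_hitIn ?_ (mulSq_xs_monomial_mem _ e)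
  rw [Finset.card_univ, Fintype.card_fin, Set.mem_singleton_iff]
  have := h.eq
  omega

theorem card_erase_univ (j : Fin k) : (Finset.univ.erase j).card + 1 = k := by
  rw [Finset.card_erase_add_one (Finset.mem_univ j), Finset.card_univ, Fintype.card_fin]

/-- In `sq (lift j g)` every summand except `lift j (sq k g)` has at most k - 2 variables in its odd
part, hence is hit. So `lift j` commutes with `sq` modulo hits. -/
theorem Step.lift_mem (h : Step k N N') (j : Fin k) {y : PolyAlg k} (hy : y ∈ hitIn k N') :
    lift j y ∈ hitIn k N := by
  refine map_mem_of_hitIn (lift j) _ (fun g => ?_) (fun e he => ?_) hy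
  · have h1 := sq_sub_mem_hitIn N (lift j g)
    rw [lift, sq_mulSq_xs, ← Finset.add_sum_erase _ _ (Finset.mem_powerset_self _), Finset.sdiff_self,
      ← lift] at h1
    have h2 : ∑ t ∈ (Finset.univ.erase j).powerset.erase (Finset.univ.erase j),
        mulSq (xs t) (xs (Finset.univ.erase j \ t) * sq k g) ∈ hitIn k N := by
      refine Submodule.sum_mem _ fun t ht => h.good t ?_ _
      rw [Finset.mem_erase, Finset.mem_powerset] at ht
      have := Finset.card_lt_card (Finset.ssubset_iff_subset_ne.2 ⟨ht.2, ht.1⟩)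
      have := card_erase_univ j
      omega
    have h3 := sub_mem h1 h2
    rw [add_sub_right_comm, add_sub_cancel_right] at h3
    rw [map_sub]
    simpa [xs] using h3
  · refine degIn_le_hitIn ?_ (mulSq_xs_monomial_mem _ e)
    have := card_erase_univ j
    have := h.eq
    rw [Set.mem_singleton_iff]
    omega

/-- The source of all relations. In the total square of x₁⋯x_k g², which is absent from degree N by
parity, only the summands with exactly one variable missing from the odd part survive. This gives
the claim for `sq k g`, and the map sees g in one degree only. -/
theorem Step.sum_lift_mem (h : Step k N N') (g : PolyAlg k) :
    ∑ j, lift j (X j * g) ∈ hitIn k N := by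
  let φ : PolyAlg k →ₗ[ZMod 2] PolyAlg k :=
    ∑ j, (lift j).comp (LinearMap.mulLeft (ZMod 2) (X j))
  have hφ : ∀ g, φ g = ∑ j, lift j (X j * g) := fun g => by simp [φ]
  rw [← hφ]
  refine map_mem_of_sq φ _ (N' - 1) (fun e he => ?_) (fun g => ?_) g
  · rw [hφ]
    refine Submodule.sum_mem _ fun j _ => ?_
    rw [← monomial_single_add]
    refine degIn_le_hitIn ?_ (mulSq_xs_monomial_mem _ _)
    have := card_erase_univ j
    have := h.eq
    rw [Set.mem_singleton_iff, map_add, Finsupp.degree_single]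
    omega
  · rw [hφ]
    have h1 := add_mem (sq_sub_mem_hitIn N (mulSq (xs Finset.univ) g)) (h.univ_mem g)
    rw [sub_add_cancel, sq_mulSq_xs] at h1
    let A : Finset (Finset (Fin k)) := Finset.univ.image fun j => Finset.univ.erase j
    have hA : A ⊆ Finset.univ.powerset := fun t _ => by simp
    rw [← Finset.sum_sdiff hA] at h1
    have h2 : ∑ t ∈ Finset.univ.powerset \ A, mulSq (xs t) (xs (Finset.univ \ t) * sq k g) ∈
        hitIn k N := by
      refine Submodule.sum_mem _ fun t ht => ?_
      by_cases ht' : t = Finset.univ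
      · subst ht'
        exact h.univ_mem _
      refine h.good t ?_ _
      have h3 := Finset.card_lt_card (Finset.ssubset_univ_iff.2 ht')
      rw [Finset.card_univ, Fintype.card_fin] at h3
      by_contra h4
      have h5 : tᶜ.card = 1 := by rw [Finset.card_compl, Fintype.card_fin]; omega
      obtain ⟨j, hj⟩ := Finset.card_eq_one.1 h5
      refine (Finset.mem_sdiff.1 ht).2 (Finset.mem_image.2 ⟨j, Finset.mem_univ j, ?_⟩)
      rw [← Finset.sdiff_singleton_eq_erase, ← hj, ← Finset.compl_eq_univ_sdiff, compl_compl]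
    have h3 := sub_mem h1 h2
    rw [add_sub_cancel_left, Finset.sum_image] at h3
    · convert h3 using 2 with j
      rw [lift, Finset.sdiff_erase_self (Finset.mem_univ j)]
      simp [xs]
    · intro i _ j _ hij
      exact (Finset.erase_inj _ (Finset.mem_univ i)).1 hij

/-! ### Iterated lifts depend only on the set of omitted variables -/

/-- A chain of `d` steps from degree `N` down to degree `M`. -/
def Chain (k : ℕ) : ℕ → ℕ → ℕ → Prop
  | 0, N, M => N = M
  | d + 1, N, M => ∃ N', Step k N N' ∧ Chain k d N' M

/-- The composite of the maps `lift j` along a list. -/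
noncomputable def lifts (J : List (Fin k)) : PolyAlg k →ₗ[ZMod 2] PolyAlg k :=
  J.foldr (fun j φ => (lift j).comp φ) LinearMap.id

@[simp] theorem lifts_nil (y : PolyAlg k) : lifts [] y = y := rfl

@[simp] theorem lifts_cons (j : Fin k) (J : List (Fin k)) (y : PolyAlg k) :
    lifts (j :: J) y = lift j (lifts J y) := rfl

theorem lifts_append (J J' : List (Fin k)) (y : PolyAlg k) :
    lifts (J ++ J') y = lifts J (lifts J' y) := by
  induction J with
  | nil => rfl
  | cons j J ih => rw [List.cons_append, lifts_cons, ih, lifts_cons]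

theorem Chain.lifts_mem {M : ℕ} {J : List (Fin k)} (h : Chain k J.length N M) {y : PolyAlg k}
    (hy : y ∈ hitIn k M) : lifts J y ∈ hitIn k N := by
  induction J generalizing N with
  | nil => exact (show N = M from h) ▸ hy
  | cons j J ih =>
    obtain ⟨N', h1, h2⟩ := h
    exact h1.lift_mem j (ih h2)

theorem Chain.split {M a b : ℕ} (h : Chain k (a + b) N M) :
    ∃ N', Chain k a N N' ∧ Chain k b N' M := by
  induction a generalizing N with
  | zero => exact ⟨N, rfl, by simpa using h⟩
  | succ a ih =>
    rw [Nat.add_right_comm] at h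
    obtain ⟨N1, h1, h2⟩ := h
    obtain ⟨N2, h3, h4⟩ := ih h2
    exact ⟨N2, ⟨N1, h1, h3⟩, h4⟩

/-- Two lists give the same lifts up to hit polynomials. -/
def Equi (J J' : List (Fin k)) : Prop :=
  J.length = J'.length ∧
    ∀ N M, Chain k J.length N M → ∀ y, lifts J y - lifts J' y ∈ hitIn k N

theorem Equi.refl (J : List (Fin k)) : Equi J J :=
  ⟨rfl, fun _ _ _ y => by rw [sub_self]; exact zero_mem _⟩

theorem Equi.trans {J J' J'' : List (Fin k)} (h : Equi J J') (h' : Equi J' J'') : Equi J J'' :=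
  ⟨h.1.trans h'.1, fun N M hc y => by
    have := add_mem (h.2 N M hc y) (h'.2 N M (h.1 ▸ hc) y)
    rwa [sub_add_sub_cancel] at this⟩

theorem Equi.symm {J J' : List (Fin k)} (h : Equi J J') : Equi J' J :=
  ⟨h.1.symm, fun N M hc y => by
    have := neg_mem (h.2 N M (h.1.symm ▸ hc) y)
    rwa [neg_sub] at this⟩

theorem Equi.cons (j : Fin k) {J J' : List (Fin k)} (h : Equi J J') : Equi (j :: J) (j :: J') :=
  ⟨by simp [h.1], fun N M hc y => by
    obtain ⟨N', h1, h2⟩ := hc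
    rw [lifts_cons, lifts_cons, ← map_sub]
    exact h1.lift_mem j (h.2 N' M h2 y)⟩

theorem X_mul_xs_sdiff_pair {a b : Fin k} (hab : a ≠ b) :
    X a * xs (Finset.univ \ {a, b}) = xs (Finset.univ.erase b) := by
  rw [← X_mul_xs_erase (s := Finset.univ.erase b) (j := a) (by simp [hab])]
  congr 2
  ext i; simp

/-- The relation `∑ ψ_j (x_j g) = 0` evaluated at `g = x₁ ⋯ x̂_a ⋯ x̂_b ⋯ x_k w²`. -/
theorem Good.pair_mem (hg : Good k N') (ψ : Fin k → PolyAlg k →ₗ[ZMod 2] PolyAlg k)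
    (hψ : ∀ j, ∀ y ∈ hitIn k N', ψ j y ∈ hitIn k N)
    (hsum : ∀ g, ∑ j, ψ j (X j * g) ∈ hitIn k N) {a b : Fin k} (hab : a ≠ b) (w : PolyAlg k) :
    ψ a (lift b w) - ψ b (lift a w) ∈ hitIn k N := by
  have h1 := hsum (mulSq (xs (Finset.univ \ {a, b})) w)
  have hp : ({a, b} : Finset (Fin k)) ⊆ Finset.univ := Finset.subset_univ _
  rw [← Finset.sum_sdiff hp, Finset.sum_pair hab] at h1
  -- For j other than a and b, multiplying by x_j leaves only k - 3 odd exponents, so the argument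
  -- of `ψ j` is hit.
  have h2 : ∑ j ∈ Finset.univ \ {a, b}, ψ j (X j * mulSq (xs (Finset.univ \ {a, b})) w) ∈
      hitIn k N := by
    refine Submodule.sum_mem _ fun j hj => hψ j _ ?_
    have : X j * mulSq (xs (Finset.univ \ {a, b})) w =
        mulSq (xs ((Finset.univ \ {a, b}).erase j)) (X j * w) := by
      rw [mulSq_apply, mulSq_apply, ← mul_assoc, X_mul_xs hj]; ring
    rw [this]
    refine hg _ ?_ _
    have h3 := Finset.card_erase_add_one hj
    have h4 := Finset.card_sdiff_add_card_eq_card hp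
    rw [Finset.card_pair hab, Finset.card_univ, Fintype.card_fin] at h4
    omega
  have h3 := sub_mem h1 h2
  rw [add_sub_cancel_left, mulSq_apply, ← mul_assoc, ← mul_assoc, X_mul_xs_sdiff_pair hab,
    Finset.pair_comm, X_mul_xs_sdiff_pair hab.symm, ← lift_apply, ← lift_apply] at h3
  have h4 : ψ a (lift b w) - ψ b (lift a w) = ψ a (lift b w) + ψ b (lift a w) := by
    rw [sub_eq_iff_eq_add, add_assoc, add_self_eq_zero', add_zero]
  rwa [h4]

theorem Equi.swap (a b : Fin k) (J : List (Fin k)) : Equi (a :: b :: J) (b :: a :: J) := by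
  refine ⟨rfl, fun N M hc y => ?_⟩
  obtain ⟨N1, h1, N2, h2, -⟩ := hc
  by_cases hab : a = b
  · subst hab
    rw [sub_self]; exact zero_mem _
  · exact h2.good.pair_mem lift (fun j y hy => h1.lift_mem j hy) h1.sum_lift_mem hab _

theorem lift_X_mul (j : Fin k) (y : PolyAlg k) :
    lift j (X j * y) = X j * mulSq (xs Finset.univ) y := by
  rw [lift_apply, mulSq_apply, ← mul_assoc, X_mul_xs (Finset.mem_univ j)]; ring

/-- `lift j (X j * g)` is x_j times a polynomial independent of j. Applying `lift j` twice therefore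
still satisfies the sum relation, and `Good.pair_mem` applies to the double lifts. -/
theorem Equi.contract (a b : Fin k) (J : List (Fin k)) :
    Equi (a :: a :: b :: J) (b :: b :: a :: J) := by
  refine ⟨rfl, fun N M hc y => ?_⟩
  obtain ⟨N1, h1, N2, h2, N3, h3, -⟩ := hc
  by_cases hab : a = b
  · subst hab
    rw [sub_self]; exact zero_mem _
  · refine h3.good.pair_mem (fun j => (lift j).comp (lift j))
      (fun j y hy => h1.lift_mem j (h2.lift_mem j hy)) (fun g => ?_) hab _
    simp only [LinearMap.comp_apply, lift_X_mul]
    simpa only [lift_X_mul] using h1.sum_lift_mem (mulSq (xs Finset.univ) g)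

theorem Equi.of_perm {J J' : List (Fin k)} (h : J.Perm J') : Equi J J' := by
  induction h with
  | nil => exact Equi.refl _
  | cons j _ ih => exact ih.cons j
  | swap a b J => exact Equi.swap _ _ _
  | trans _ _ h1 h2 => exact h1.trans h2

/-- After reordering, this is aab ~ bba: an extra copy of one letter may be traded for an extra copy
of another letter already present. -/
theorem Equi.head {a b : Fin k} {J : List (Fin k)} (ha : a ∈ J) (hb : b ∈ J) :
    Equi (a :: J) (b :: J) := by
  by_cases hab : a = b
  · subst hab; exact Equi.refl _
  have h1 := List.perm_cons_erase ha
  have hb' : b ∈ J.erase a := (List.mem_erase_of_ne (Ne.symm hab)).2 hb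
  have h2 : J.Perm (a :: b :: (J.erase a).erase b) := h1.trans ((List.perm_cons_erase hb').cons a)
  have h3 : J.Perm (b :: a :: (J.erase a).erase b) := h2.trans (List.Perm.swap _ _ _)
  exact ((Equi.of_perm (h2.cons a)).trans (Equi.contract a b _)).trans
    (Equi.of_perm (h3.symm.cons b))

theorem exists_perm_cons_of_card_lt {J : List (Fin k)} (h : J.toFinset.card < J.length) :
    ∃ a J', J.Perm (a :: J') ∧ a ∈ J' := by
  have h1 : ¬ J.Nodup := fun hn => by rw [List.toFinset_card_of_nodup hn] at h; omega
  obtain ⟨a, ha⟩ := List.exists_duplicate_iff_not_nodup.2 h1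
  have h2 := List.duplicate_iff_two_le_count.1 ha
  have h3 : a ∈ J := ha.mem
  refine ⟨a, J.erase a, List.perm_cons_erase h3, ?_⟩
  rw [← List.count_pos_iff, List.count_erase_self]
  omega

/-- The class of a lift depends only on the set of omitted variables. -/
theorem Equi.of_toFinset {J J' : List (Fin k)} (hl : J.length = J'.length)
    (hs : J.toFinset = J'.toFinset) : Equi J J' := by
  induction h : J.length generalizing J J' with
  | zero =>
    rw [List.length_eq_zero_iff] at h
    subst h
    rw [List.length_nil, eq_comm, List.length_eq_zero_iff] at hl
    subst hl
    exact Equi.refl _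
  | succ n ih =>
    rcases (List.toFinset_card_le J).lt_or_eq with hlt | heq
    -- Both lists have a repeated letter. Removing one copy keeps the underlying set, so induction
    -- applies to the tails, and `Equi.head` exchanges the removed letters.
    · obtain ⟨a, J1, hJ, ha⟩ := exists_perm_cons_of_card_lt hlt
      obtain ⟨b, J2, hJ', hb⟩ := exists_perm_cons_of_card_lt (J := J') (by rw [← hs, ← hl]; exact hlt)
      have e1 : J.toFinset = J1.toFinset := by
        rw [List.toFinset_eq_of_perm _ _ hJ, List.toFinset_cons, Finset.insert_eq_self]
        exact List.mem_toFinset.2 ha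
      have e2 : J'.toFinset = J2.toFinset := by
        rw [List.toFinset_eq_of_perm _ _ hJ', List.toFinset_cons, Finset.insert_eq_self]
        exact List.mem_toFinset.2 hb
      have l1 := hJ.length_eq
      have l2 := hJ'.length_eq
      rw [List.length_cons] at l1 l2
      have h3 : Equi J1 J2 := ih (by omega) (by rw [← e1, ← e2, hs]) (by omega)
      have hb' : b ∈ J1 := by
        rw [← List.mem_toFinset, ← e1, hs, e2]; exact List.mem_toFinset.2 hb
      exact (((Equi.of_perm hJ).trans (Equi.head ha hb')).trans (h3.cons b)).trans
        (Equi.of_perm hJ').symm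
    · have n1 : J.Nodup := (Multiset.toFinset_card_eq_card_iff_nodup (m := (J : Multiset (Fin k)))).1 heq
      have n2 : J'.Nodup := (Multiset.toFinset_card_eq_card_iff_nodup (m := (J' : Multiset (Fin k)))).1
        (show J'.toFinset.card = J'.length by rw [← hs, ← hl]; exact heq)
      exact Equi.of_perm ((List.perm_ext_iff_of_nodup n1 n2).2 fun a => by
        rw [← List.mem_toFinset, hs, List.mem_toFinset])

end HitProblem

/-! ### Generators indexed by sets, and their relations -/

namespace HitProblem

open MvPolynomial

variable {k : ℕ} {N M d : ℕ}

theorem exists_list {S : Finset (Fin k)} (h : S.Nonempty ∧ S.card ≤ d) :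
    ∃ J : List (Fin k), J.length = d ∧ J.toFinset = S := by
  obtain ⟨⟨a, ha⟩, hd⟩ := h
  refine ⟨S.toList ++ List.replicate (d - S.card) a, ?_, ?_⟩
  · rw [List.length_append, Finset.length_toList, List.length_replicate]
    omega
  · ext i
    simp only [List.mem_toFinset, List.mem_append, Finset.mem_toList, List.mem_replicate]
    constructor
    · rintro (h | ⟨-, rfl⟩)
      exacts [h, ha]
    · exact Or.inl

open Classical in
/-- The `d`-fold lift along a list with underlying set `S`. -/
noncomputable def setLift (d : ℕ) (S : Finset (Fin k)) : PolyAlg k →ₗ[ZMod 2] PolyAlg k :=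
  if h : S.Nonempty ∧ S.card ≤ d then lifts (exists_list h).choose else 0

theorem exists_setLift_eq {S : Finset (Fin k)} (h : S.Nonempty ∧ S.card ≤ d) :
    ∃ J : List (Fin k), J.length = d ∧ J.toFinset = S ∧ setLift d S = lifts J :=
  ⟨(exists_list h).choose, (exists_list h).choose_spec.1, (exists_list h).choose_spec.2,
    dif_pos h⟩

theorem setLift_of_not {S : Finset (Fin k)} (h : ¬(S.Nonempty ∧ S.card ≤ d)) :
    setLift d S = 0 := dif_neg h

theorem Chain.setLift_mem (hc : Chain k d N M) (S : Finset (Fin k)) {y : PolyAlg k}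
    (hy : y ∈ hitIn k M) : setLift d S y ∈ hitIn k N := by
  by_cases h : S.Nonempty ∧ S.card ≤ d
  · obtain ⟨J, rfl, -, h3⟩ := exists_setLift_eq h
    rw [h3]
    exact hc.lifts_mem hy
  · rw [setLift_of_not h]
    exact zero_mem _

theorem Chain.lifts_sub_setLift_mem (hc : Chain k d N M) {J : List (Fin k)} (hJ : J.length = d)
    {S : Finset (Fin k)} (hS : J.toFinset = S) (hd : 0 < d) (y : PolyAlg k) :
    lifts J y - setLift d S y ∈ hitIn k N := by
  have h : S.Nonempty ∧ S.card ≤ d := by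
    rw [← hS, ← hJ]
    refine ⟨?_, List.toFinset_card_le J⟩
    rw [List.toFinset_nonempty_iff]
    rintro rfl
    simp at hJ
    omega
  obtain ⟨J', h1, h2, h3⟩ := exists_setLift_eq h
  rw [h3]
  subst hJ
  exact (Equi.of_toFinset h1.symm (hS.trans h2.symm)).2 N M hc y

/-- Modulo hits, only monomials with exactly k - 1 odd exponents survive in the top degree of a
step. These are lifts, and the argument repeats on the polynomial being lifted. -/
theorem Chain.mem_of_lifts_mem (hc : Chain k d N M) {W : Submodule (ZMod 2) (PolyAlg k)}
    (h1 : hitIn k N ≤ W) (h2 : ∀ J : List (Fin k), J.length = d → ∀ y, lifts J y ∈ W)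
    (f : PolyAlg k) : f ∈ W := by
  induction d generalizing N W f with
  | zero => exact h2 [] rfl f
  | succ d ih =>
    obtain ⟨N', hs, hc⟩ := hc
    refine map_mem_of_monomial LinearMap.id W (fun e => ?_) f
    obtain ⟨s, e', he⟩ := monomial_eq_mulSq e
    rw [LinearMap.id_apply, he]
    by_cases h3 : s.card + 1 < k
    · exact h1 (hs.good s h3 _)
    by_cases h4 : s = Finset.univ
    · subst h4; exact h1 (hs.univ_mem _)
    have h5 := Finset.card_lt_card (Finset.ssubset_univ_iff.2 h4)
    rw [Finset.card_univ, Fintype.card_fin] at h5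
    have h6 : sᶜ.card = 1 := by rw [Finset.card_compl, Fintype.card_fin]; omega
    obtain ⟨j, hj⟩ := Finset.card_eq_one.1 h6
    have h7 : s = Finset.univ.erase j := by
      rw [← Finset.sdiff_singleton_eq_erase, ← hj, ← Finset.compl_eq_univ_sdiff, compl_compl]
    rw [h7, ← lift]
    exact ih hc (W := W.comap (lift j)) (fun y hy => h1 (hs.lift_mem j hy))
      (fun J hJ y => h2 (j :: J) (by simp [hJ]) y) _

theorem Chain.exists_sum_setLift (hc : Chain k d N M) (hd : 0 < d) (f : PolyAlg k) :
    ∃ y : Finset (Fin k) → PolyAlg k, (∀ S, ¬(S.Nonempty ∧ S.card ≤ d) → y S = 0) ∧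
      f - ∑ S, setLift d S (y S) ∈ hitIn k N := by
  classical
  let Θ : (Finset (Fin k) → PolyAlg k) →ₗ[ZMod 2] PolyAlg k :=
    ∑ S, (setLift d S).comp (LinearMap.proj S)
  have hΘ : ∀ y, Θ y = ∑ S, setLift d S (y S) := fun y => by simp [Θ]
  have h : f ∈ hitIn k N ⊔ LinearMap.range Θ := by
    refine hc.mem_of_lifts_mem le_sup_left (fun J hJ y => ?_) f
    have h1 : Θ (Pi.single J.toFinset y) = setLift d J.toFinset y := by
      rw [hΘ, Finset.sum_eq_single J.toFinset, Pi.single_eq_same]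
      · intro S _ hS
        rw [Pi.single_eq_of_ne hS, map_zero]
      · simp
    have h2 := hc.lifts_sub_setLift_mem hJ rfl hd y
    have h3 : setLift d J.toFinset y ∈ hitIn k N ⊔ LinearMap.range Θ :=
      Submodule.mem_sup_right ⟨_, h1⟩
    have := add_mem ((le_sup_left : hitIn k N ≤ hitIn k N ⊔ LinearMap.range Θ) h2) h3
    rwa [sub_add_cancel] at this
  obtain ⟨r, hr, _, ⟨y, rfl⟩, rfl⟩ := Submodule.mem_sup.1 h
  -- Setting y to 0 where `setLift` vanishes does not change the sum. It makes the coefficient at ∅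
  -- zero, and also that at the full set when d = k - 1.
  refine ⟨fun S => if S.Nonempty ∧ S.card ≤ d then y S else 0, fun S hS => if_neg hS, ?_⟩
  convert hr using 1
  rw [hΘ, add_sub_assoc, add_eq_left, sub_eq_zero]
  refine Finset.sum_congr rfl fun S _ => ?_
  dsimp only
  split_ifs with hS
  · rfl
  · rw [setLift_of_not hS]; rfl

theorem lifts_replicate_X_mul (s : ℕ) (u : PolyAlg k) :
    ∃ v, ∀ j : Fin k, lifts (List.replicate s j) (X j * u) = X j * v := by
  induction s with
  | zero => exact ⟨u, fun j => rfl⟩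
  | succ s ih =>
    obtain ⟨v, hv⟩ := ih
    exact ⟨mulSq (xs Finset.univ) v, fun j => by
      rw [List.replicate_succ, lifts_cons, hv, lift_X_mul]⟩

theorem Chain.sum_lifts_replicate_mem {s : ℕ} (hc : Chain k (s + 1) N M) (u : PolyAlg k) :
    ∑ j : Fin k, lifts (List.replicate (s + 1) j) (X j * u) ∈ hitIn k N := by
  obtain ⟨v, hv⟩ := lifts_replicate_X_mul s u
  obtain ⟨N', h1, -⟩ := hc
  simp_rw [List.replicate_succ, lifts_cons, hv]
  exact h1.sum_lift_mem v

/-- Lift along the elements of T the relation for d - |T| equal letters j. The bound on |T| leaves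
room for at least one j. -/
theorem Chain.relation (hc : Chain k d N M) {T : Finset (Fin k)} (hT : T.card < d)
    (u : PolyAlg k) : ∑ j, setLift d (insert j T) (X j * u) ∈ hitIn k N := by
  obtain ⟨s, rfl⟩ : ∃ s, d = T.toList.length + (s + 1) :=
    ⟨d - T.card - 1, by rw [Finset.length_toList]; omega⟩
  have h1 : ∑ j, lifts (T.toList ++ List.replicate (s + 1) j) (X j * u) ∈ hitIn k N := by
    obtain ⟨N', h2, h3⟩ := Chain.split hc
    simp_rw [lifts_append, ← map_sum]
    exact h2.lifts_mem (h3.sum_lifts_replicate_mem u)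
  have h2 : ∑ j, (lifts (T.toList ++ List.replicate (s + 1) j) (X j * u) -
      setLift (T.toList.length + (s + 1)) (insert j T) (X j * u)) ∈ hitIn k N := by
    refine Submodule.sum_mem _ fun j _ =>
      hc.lifts_sub_setLift_mem (by simp) ?_ (by omega) _
    ext i
    simp [List.mem_replicate, or_comm]
  rw [Finset.sum_sub_distrib] at h2
  have := sub_mem h1 h2
  rwa [sub_sub_cancel] at this

/-! ### Linear algebra over the Boolean lattice modulo 2 -/

section Cube

variable {V : Type*} [AddCommGroup V] [Module (ZMod 2) V]
variable (e : Finset (Fin k) → PolyAlg k →ₗ[ZMod 2] V)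

/-- The linear form `∑_{j ∈ L} x_j`. -/
noncomputable def form (L : Finset (Fin k)) : PolyAlg k := ∑ j ∈ L, X j

/-- The sum of `e S` over the supersets `S` of `L`. -/
noncomputable def upSum (L : Finset (Fin k)) : PolyAlg k →ₗ[ZMod 2] V :=
  ∑ S with L ⊆ S, e S

/-- The sum `∑_j e_{T ∪ {j}}(x_j u)`. -/
noncomputable def relSum (T : Finset (Fin k)) : PolyAlg k →ₗ[ZMod 2] V :=
  ∑ j, (e (insert j T)).comp (LinearMap.mulLeft (ZMod 2) (X j))

theorem upSum_apply (L : Finset (Fin k)) (y : PolyAlg k) :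
    upSum e L y = ∑ S with L ⊆ S, e S y := by simp [upSum]

theorem relSum_apply (T : Finset (Fin k)) (u : PolyAlg k) :
    relSum e T u = ∑ j, e (insert j T) (X j * u) := by simp [relSum]

/-- For j outside L, the sets T with and without j contribute equally and cancel. For j in L,
inserting j does nothing. -/
theorem sum_relSum (L : Finset (Fin k)) (u : PolyAlg k) :
    ∑ T with L ⊆ T, relSum e T u = upSum e L (form L * u) := by
  simp_rw [relSum_apply]
  rw [Finset.sum_comm, form, Finset.sum_mul, map_sum,
    ← Finset.sum_subset (Finset.subset_univ L)]
  · refine Finset.sum_congr rfl fun j hj => ?_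
    rw [upSum_apply]
    refine Finset.sum_congr rfl fun T hT => ?_
    rw [Finset.insert_eq_self.2 ((Finset.mem_filter.1 hT).2 hj)]
  · intro j _ hj
    refine Finset.sum_involution (fun T _ => if j ∈ T then T.erase j else insert j T) ?_ ?_ ?_ ?_
    · intro T hT
      split_ifs with h
      · rw [Finset.insert_erase h, Finset.insert_eq_self.2 h, add_self_eq_zero']
      · rw [Finset.insert_idem, add_self_eq_zero']
    · intro T hT _
      split_ifs with h
      · intro h'; rw [← h'] at h; simp at h
      · intro h'; rw [← h'] at h; simp at h
    · intro T hT
      rw [Finset.mem_filter] at hT ⊢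
      refine ⟨Finset.mem_univ _, ?_⟩
      split_ifs with h
      · exact Finset.subset_erase.2 ⟨hT.2, hj⟩
      · exact hT.2.trans (Finset.subset_insert _ _)
    · intro T hT
      by_cases h : j ∈ T
      · simp [h]
      · simp [h]

/-- The case L = ∅ of `sum_relSum` says that all relation sums add up to 0, so the supersets of L
may be replaced by their complement. -/
theorem upSum_form_mul (L : Finset (Fin k)) (u : PolyAlg k) :
    upSum e L (form L * u) = ∑ T with ¬L ⊆ T, relSum e T u := by
  have h1 := Finset.sum_filter_add_sum_filter_not Finset.univ (fun T => L ⊆ T)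
    (fun T => relSum e T u)
  have h2 := sum_relSum e ∅ u
  simp only [Finset.empty_subset, Finset.filter_true, form, Finset.sum_empty, zero_mul,
    map_zero] at h2
  rw [h2, sum_relSum] at h1
  exact eq_of_add_eq_zero' h1

/-- A set T that does not contain L and omits at most one element is the complement of some i in L.
-/
theorem upSum_form_mul_eq (he : ∀ T, T.card + 2 ≤ k → relSum e T = 0) (L : Finset (Fin k))
    (u : PolyAlg k) :
    upSum e L (form L * u) = ∑ i ∈ L, relSum e (Finset.univ.erase i) u := by
  rw [upSum_form_mul]
  have hinj : Set.InjOn (fun i : Fin k => Finset.univ.erase i) L := fun i _ j _ hij =>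
    (Finset.erase_inj _ (Finset.mem_univ i)).1 hij
  rw [← Finset.sum_image (f := fun T => relSum e T u) hinj]
  symm
  refine Finset.sum_subset ?_ ?_
  · intro T hT
    obtain ⟨i, hi, rfl⟩ := Finset.mem_image.1 hT
    rw [Finset.mem_filter]
    refine ⟨Finset.mem_univ _, fun h => ?_⟩
    simpa using h hi
  · intro T hT hT'
    rw [Finset.mem_filter] at hT
    obtain ⟨i, hi, hiT⟩ := Finset.not_subset.1 hT.2
    rw [he T, LinearMap.zero_apply]
    by_contra hc
    refine hT' (Finset.mem_image.2 ⟨i, hi, ?_⟩)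
    refine (Finset.eq_of_subset_of_card_le ?_ ?_).symm
    · exact Finset.subset_erase.2 ⟨Finset.subset_univ _, hiT⟩
    · have := card_erase_univ i
      omega

/-- The number of sets between `S` and `T` is odd only if `S = T`. -/
theorem sum_between (S T : Finset (Fin k)) (v : V) :
    ∑ L with S ⊆ L ∧ L ⊆ T, v = if S = T then v else 0 := by
  have h0 : Finset.univ.filter (fun L => S ⊆ L ∧ L ⊆ T) = Finset.Icc S T := by
    ext L; simp
  rw [h0, Finset.sum_const]
  by_cases h : S ⊆ T
  · rw [Finset.card_Icc_finset h]
    split_ifs with h'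
    · subst h'; simp
    · have h1 := Finset.card_lt_card (Finset.ssubset_iff_subset_ne.2 ⟨h, h'⟩)
      obtain ⟨c, hc⟩ : ∃ c, T.card - S.card = c + 1 := ⟨T.card - S.card - 1, by omega⟩
      rw [hc, pow_succ, mul_nsmul, two_nsmul, add_self_eq_zero']
  · rw [if_neg (fun h' => h h'.subset), Finset.Icc_eq_empty (fun h' => h h'), Finset.card_empty,
      zero_nsmul]

/-- Möbius inversion: modulo 2 the Möbius function of the subset lattice is 1 on every interval. -/
theorem sum_eq_sum_upSum (y : Finset (Fin k) → PolyAlg k) :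
    ∑ S, e S (y S) = ∑ L, upSum e L (∑ S with S ⊆ L, y S) := by
  simp_rw [upSum_apply, map_sum, Finset.sum_filter]
  rw [Finset.sum_comm]
  refine Finset.sum_congr rfl fun T _ => ?_
  have h1 : ∀ L, (if L ⊆ T then ∑ S, (if S ⊆ L then e T (y S) else 0) else 0) =
      ∑ S, if S ⊆ L ∧ L ⊆ T then e T (y S) else 0 := by
    intro L
    split_ifs with h <;> simp [h]
  simp_rw [h1]
  rw [Finset.sum_comm]
  simp_rw [← Finset.sum_filter, sum_between]
  simp

theorem upSum_eq_zero (he0 : ∀ S, ∀ y ∈ hitIn k M, e S y = 0) (L : Finset (Fin k))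
    {y : PolyAlg k} (hy : y ∈ hitIn k M) : upSum e L y = 0 := by
  rw [upSum_apply]
  exact Finset.sum_eq_zero fun S _ => he0 S y hy

theorem relSum_erase (he : ∀ T, T.card + 2 ≤ k → relSum e T = 0) (i : Fin k) (u : PolyAlg k) :
    relSum e (Finset.univ.erase i) u = upSum e {i} (X i * u) := by
  have := upSum_form_mul_eq e he {i} u
  rw [form, Finset.sum_singleton, Finset.sum_singleton] at this
  exact this.symm

theorem sq_form (L : Finset (Fin k)) : sq k (form L) = form L + form L ^ 2 := by
  rw [form, map_sum, sum_pow_char, ← Finset.sum_add_distrib]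
  exact Finset.sum_congr rfl fun j _ => sq_X j

/-- The compatibility needed for `exists_section`. With ℓ = `form L`, `sq` sends ℓg to (ℓ + ℓ²) `sq
g`; as `upSum` kills hits, this yields an identity for each L. The identities for {i}, {j} and {i,
j} differ exactly by the cross terms, which gives the symmetry for u = `sq g`. -/
theorem relSum_erase_symm (he0 : ∀ S, ∀ y ∈ hitIn k M, e S y = 0)
    (he : ∀ T, T.card + 2 ≤ k → relSum e T = 0) (i j : Fin k) (u : PolyAlg k) :
    relSum e (Finset.univ.erase i) (X j * u) = relSum e (Finset.univ.erase j) (X i * u) := by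
  by_cases hij : i = j
  · rw [hij]
  have hL : ∀ L g, ∑ i ∈ L, relSum e (Finset.univ.erase i) (sq k g + form L * sq k g) =
      ∑ i ∈ L, relSum e (Finset.univ.erase i) g := by
    intro L g
    rw [← upSum_form_mul_eq e he, ← upSum_form_mul_eq e he, ← sub_eq_zero, ← map_sub]
    refine upSum_eq_zero e he0 L ?_
    have := sq_sub_mem_hitIn M (form L * g)
    rw [map_mul, sq_form] at this
    convert this using 2
    ring
  let φ : PolyAlg k →ₗ[ZMod 2] V :=
    (relSum e (Finset.univ.erase i)).comp (LinearMap.mulLeft (ZMod 2) (X j)) -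
      (relSum e (Finset.univ.erase j)).comp (LinearMap.mulLeft (ZMod 2) (X i))
  have hφ : ∀ u, φ u = relSum e (Finset.univ.erase i) (X j * u) -
      relSum e (Finset.univ.erase j) (X i * u) := fun u => rfl
  have h := map_mem_of_sq φ ⊥ (M - 2) (fun c hc => ?_) (fun g => ?_) u
  · rwa [Submodule.mem_bot, hφ, sub_eq_zero] at h
  · have hz : ∀ a b : Fin k, X a * (X b * monomial c 1) ∈ hitIn k M := by
      intro a b
      rw [← monomial_single_add, ← monomial_single_add]
      refine degIn_le_hitIn (A := {1 + (1 + c.degree)}) ?_ (monomial_mem_degIn 1 (by simp))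
      rw [Set.mem_singleton_iff]
      omega
    rw [Submodule.mem_bot, hφ, relSum_erase e he, relSum_erase e he,
      upSum_eq_zero e he0 _ (hz i j), upSum_eq_zero e he0 _ (hz j i), sub_zero]
  · have h1 := hL {i} g
    have h2 := hL {j} g
    have h3 := hL {i, j} g
    simp only [form, Finset.sum_singleton, Finset.sum_pair hij, add_mul, map_add] at h1 h2 h3
    rw [Submodule.mem_bot, hφ, sub_eq_zero]
    refine eq_of_add_eq_zero' ?_
    rw [← h1, ← h2] at h3
    rw [← sub_eq_zero] at h3
    rw [← h3]
    abel

/-- Apart from the constants, each spanning element of `hitIn k M` built from a monomial is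
divisible by a variable, since `sq` preserves divisibility by x_i. -/
theorem map_eq_zero_of_hitIn (σ : PolyAlg k →ₗ[ZMod 2] V) (h1 : σ 1 = 0)
    (h : ∀ i u, X i * u ∈ hitIn k M → σ (X i * u) = 0) {y : PolyAlg k} (hy : y ∈ hitIn k M) :
    σ y = 0 := by
  have h0 : (monomial 0 1 : PolyAlg k) = 1 := rfl
  rw [← Submodule.mem_bot (ZMod 2)]
  refine map_mem_of_hitIn σ ⊥ (fun g => ?_) (fun c hc => ?_) hy
  · refine map_mem_of_monomial (σ.comp ((sq k).toLinearMap - LinearMap.id)) ⊥ (fun c => ?_) g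
    rw [Submodule.mem_bot, LinearMap.comp_apply, LinearMap.sub_apply, AlgHom.toLinearMap_apply,
      LinearMap.id_apply]
    induction c using exponent_induction with
    | h0 => rw [h0, map_one, sub_self, map_zero]
    | hs c i _ =>
      have h2 : sq k (X i * monomial c 1) - X i * monomial c 1 =
          X i * ((1 + X i) * sq k (monomial c 1) - monomial c 1) := by
        rw [map_mul, sq_X]; ring
      rw [monomial_single_add, h2]
      refine h _ _ ?_
      rw [← h2]
      exact sq_sub_mem_hitIn M _
  · rw [Submodule.mem_bot]
    induction c using exponent_induction with
    | h0 => rw [h0, h1]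
    | hs c i _ =>
      rw [monomial_single_add]
      refine h _ _ ?_
      rw [← monomial_single_add]
      exact degIn_le_hitIn (A := {(Finsupp.single i 1 + c).degree})
        (fun h => hc h.symm) (monomial_mem_degIn 1 rfl)

/-- Under the relations in codimension at least two, `x_i u ↦ relSum e (univ \ i) u` is a
well-defined map which vanishes on hit polynomials. -/
theorem exists_section (he0 : ∀ S, ∀ y ∈ hitIn k M, e S y = 0)
    (he : ∀ T, T.card + 2 ≤ k → relSum e T = 0) :
    ∃ σ : PolyAlg k →ₗ[ZMod 2] V,
      (∀ i u, σ (X i * u) = relSum e (Finset.univ.erase i) u) ∧ ∀ y ∈ hitIn k M, σ y = 0 := by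
  classical
  -- On a nonconstant monomial, divide by an arbitrarily chosen variable; `relSum_erase_symm` makes
  -- the choice irrelevant. Constants go to 0.
  let f : (Fin k →₀ ℕ) → V := fun c =>
    if h : ∃ i, c i ≠ 0 then
      relSum e (Finset.univ.erase h.choose) (monomial (c - Finsupp.single h.choose 1) 1)
    else 0
  let σ : PolyAlg k →ₗ[ZMod 2] V := (basisMonomials (Fin k) (ZMod 2)).constr (ZMod 2) f
  have hσ : ∀ c, σ (monomial c 1) = f c := fun c => by
    have := (basisMonomials (Fin k) (ZMod 2)).constr_basis (ZMod 2) f c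
    rwa [coe_basisMonomials] at this
  have hX : ∀ i c, σ (X i * monomial c 1) = relSum e (Finset.univ.erase i) (monomial c 1) := by
    intro i c
    have h : ∃ j, (Finsupp.single i 1 + c : Fin k →₀ ℕ) j ≠ 0 := ⟨i, by simp⟩
    rw [← monomial_single_add, hσ]
    simp only [f]
    rw [dif_pos h]
    have hj := h.choose_spec
    generalize h.choose = j at hj
    by_cases hij : i = j
    · subst hij; rw [add_tsub_cancel_left]
    · have h1 : c j ≠ 0 := by simpa [Finsupp.single_eq_of_ne (Ne.symm hij)] using hj
      have hle : Finsupp.single j 1 ≤ c := by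
        rw [Finsupp.single_le_iff]; exact Nat.one_le_iff_ne_zero.2 h1
      obtain ⟨c', rfl⟩ := exists_add_of_le hle
      rw [add_left_comm, add_tsub_cancel_left, monomial_single_add, monomial_single_add]
      exact relSum_erase_symm e he0 he j i _
  have hXu : ∀ i u, σ (X i * u) = relSum e (Finset.univ.erase i) u := by
    intro i u
    have h := map_mem_of_monomial
      (σ.comp (LinearMap.mulLeft (ZMod 2) (X i)) - relSum e (Finset.univ.erase i)) ⊥
      (fun c => by
        rw [Submodule.mem_bot, LinearMap.sub_apply, sub_eq_zero]
        exact hX i c) u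
    rw [Submodule.mem_bot, LinearMap.sub_apply, sub_eq_zero] at h
    exact h
  have h1 : σ 1 = 0 := by
    have : (1 : PolyAlg k) = monomial 0 1 := rfl
    rw [this, hσ]
    simp [f]
  refine ⟨σ, hXu, fun y hy => map_eq_zero_of_hitIn σ h1 (fun i u hu => ?_) hy⟩
  rw [hXu, relSum_erase e he]
  exact upSum_eq_zero e he0 _ hu

end Cube
end HitProblem

/-! ### Restriction to hyperplanes and Kameko's map -/

namespace HitProblem

open MvPolynomial

theorem algHom_mem_hitIn {a b N : ℕ} (φ : PolyAlg a →ₐ[ZMod 2] PolyAlg b)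
    (h1 : ∀ j, φ (X j) ∈ degIn b {1}) (h2 : ∀ f, φ (sq a f) = sq b (φ f)) {f : PolyAlg a}
    (hf : f ∈ hitIn a N) : φ f ∈ hitIn b N := by
  refine map_mem_of_hitIn φ.toLinearMap _ (fun g => ?_) (fun e he => ?_) hf
  · rw [AlgHom.toLinearMap_apply, map_sub, h2]
    exact sq_sub_mem_hitIn N _
  · refine degIn_le_hitIn (A := {e.degree}) (fun h => he h.symm) ?_
    rw [AlgHom.toLinearMap_apply]
    clear he
    induction e using exponent_induction with
    | h0 =>
      have : (monomial 0 1 : PolyAlg a) = 1 := rfl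
      rw [this, map_one]
      simpa using one_mem_degIn
    | hs e j ih =>
      rw [monomial_single_add, map_mul, map_add, Finsupp.degree_single]
      exact mul_mem_degIn (h1 j) ih (by simp)

theorem form_mem_degIn {k : ℕ} (L : Finset (Fin k)) : form L ∈ degIn k {1} :=
  Submodule.sum_mem _ fun j _ => X_mem_degIn j

variable {q : ℕ}

/-- The projection of `P_{q+1}` onto `P_q` killing the linear form `form L`, where `p ∈ L`. -/
noncomputable def proj (p : Fin (q + 1)) (L : Finset (Fin (q + 1))) :
    PolyAlg (q + 1) →ₐ[ZMod 2] PolyAlg q :=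
  aeval (p.insertNth (α := fun _ => PolyAlg q) (form {i | p.succAbove i ∈ L}) X)

/-- The inclusion of `P_q` into `P_{q+1}` omitting the variable `x_p`. -/
noncomputable def incl (p : Fin (q + 1)) : PolyAlg q →ₐ[ZMod 2] PolyAlg (q + 1) :=
  aeval fun i => X (p.succAbove i)

@[simp] theorem proj_X_self (p : Fin (q + 1)) (L : Finset (Fin (q + 1))) :
    proj p L (X p) = form {i | p.succAbove i ∈ L} := by
  rw [proj, aeval_X, Fin.insertNth_apply_same]

@[simp] theorem proj_X_succAbove (p : Fin (q + 1)) (L : Finset (Fin (q + 1))) (i : Fin q) :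
    proj p L (X (p.succAbove i)) = X i := by
  rw [proj, aeval_X, Fin.insertNth_apply_succAbove]

@[simp] theorem incl_X (p : Fin (q + 1)) (i : Fin q) : incl p (X i) = X (p.succAbove i) := by
  rw [incl, aeval_X]

theorem proj_incl (p : Fin (q + 1)) (L : Finset (Fin (q + 1))) (y : PolyAlg q) :
    proj p L (incl p y) = y := by
  have : (proj p L).comp (incl p) = AlgHom.id (ZMod 2) _ := by
    refine algHom_ext fun i => ?_
    simp
  exact AlgHom.congr_fun this y

theorem proj_sq (p : Fin (q + 1)) (L : Finset (Fin (q + 1))) (f : PolyAlg (q + 1)) :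
    proj p L (sq _ f) = sq _ (proj p L f) := by
  have : (proj p L).comp (sq _) = (sq _).comp (proj p L) := by
    refine algHom_ext fun j => ?_
    rcases Fin.eq_self_or_eq_succAbove p j with rfl | ⟨i, rfl⟩
    · simp [sq_form]
    · simp
  exact AlgHom.congr_fun this f

theorem incl_sq (p : Fin (q + 1)) (f : PolyAlg q) : incl p (sq _ f) = sq _ (incl p f) := by
  have : (incl p).comp (sq _) = (sq _).comp (incl p) := by
    refine algHom_ext fun j => ?_
    simp
  exact AlgHom.congr_fun this f

theorem proj_mem_hitIn {N : ℕ} (p : Fin (q + 1)) (L : Finset (Fin (q + 1)))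
    {f : PolyAlg (q + 1)} (hf : f ∈ hitIn (q + 1) N) : proj p L f ∈ hitIn q N := by
  refine algHom_mem_hitIn (proj p L) (fun j => ?_) (proj_sq p L) hf
  rcases Fin.eq_self_or_eq_succAbove p j with rfl | ⟨i, rfl⟩
  · rw [proj_X_self]; exact form_mem_degIn _
  · rw [proj_X_succAbove]; exact X_mem_degIn i

theorem incl_mem_hitIn {N : ℕ} (p : Fin (q + 1)) {f : PolyAlg q} (hf : f ∈ hitIn q N) :
    incl p f ∈ hitIn (q + 1) N :=
  algHom_mem_hitIn (incl p) (fun j => by rw [incl_X]; exact X_mem_degIn _) (incl_sq p) hf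

theorem incl_form_add (p : Fin (q + 1)) {L : Finset (Fin (q + 1))} (hp : p ∈ L) :
    X p + incl p (form {i | p.succAbove i ∈ L}) = form L := by
  have h1 : form L = ∑ j, if j ∈ L then (X j : PolyAlg (q + 1)) else 0 := by
    rw [form, ← Finset.sum_filter]
    simp
  rw [h1, Fin.sum_univ_succAbove _ p, if_pos hp, form, map_sum, Finset.sum_filter]
  simp_rw [incl_X]

theorem form_dvd_sub_incl_proj (p : Fin (q + 1)) {L : Finset (Fin (q + 1))} (hp : p ∈ L)
    (f : PolyAlg (q + 1)) : form L ∣ f - incl p (proj p L f) := by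
  induction f using MvPolynomial.induction_on with
  | C a =>
    have h1 : (C a : PolyAlg (q + 1)) = algebraMap (ZMod 2) _ a := rfl
    rw [h1, AlgHom.commutes, AlgHom.commutes, sub_self]
    exact dvd_zero _
  | add f g hf hg =>
    rw [map_add, map_add, add_sub_add_comm]
    exact dvd_add hf hg
  | mul_X f j hf =>
    have : f * X j - incl p (proj p L (f * X j)) = (f - incl p (proj p L f)) * X j +
        incl p (proj p L f) * (X j - incl p (proj p L (X j))) := by
      rw [map_mul, map_mul]; ring
    rw [this]
    refine dvd_add (hf.mul_right _) (Dvd.dvd.mul_left ?_ _)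
    rcases Fin.eq_self_or_eq_succAbove p j with rfl | ⟨i, rfl⟩
    · rw [proj_X_self, sub_eq_add_neg,
        neg_eq_of_add_eq_zero_right (add_self_eq_zero' (incl j (form {i | j.succAbove i ∈ L}))),
        incl_form_add j hp]
    · rw [proj_X_succAbove, incl_X, sub_self]
      exact dvd_zero _

/-- Modulo `form L`, w is the inclusion of its restriction, and inclusion preserves hits. -/
theorem exists_sub_form_mul_mem {M : ℕ} {p : Fin (q + 1)} {L : Finset (Fin (q + 1))} (hp : p ∈ L)
    {w : PolyAlg (q + 1)} (hw : proj p L w ∈ hitIn q M) :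
    ∃ u, w - form L * u ∈ hitIn (q + 1) M := by
  obtain ⟨u, hu⟩ := form_dvd_sub_incl_proj p hp w
  exact ⟨u, by rw [← hu, sub_sub_cancel]; exact incl_mem_hitIn p hw⟩

/-- Kameko's map, `x₁ ⋯ x_q y² ↦ y`, which kills the other monomials. -/
noncomputable def kameko (q : ℕ) : PolyAlg q →ₗ[ZMod 2] PolyAlg q :=
  (basisMonomials (Fin q) (ZMod 2)).constr (ZMod 2) fun e =>
    if ∀ i, Odd (e i) then monomial (e.mapRange (· / 2) rfl) 1 else 0

theorem kameko_monomial (e : Fin q →₀ ℕ) :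
    kameko q (monomial e 1) =
      if ∀ i, Odd (e i) then monomial (e.mapRange (· / 2) rfl) 1 else 0 := by
  have := (basisMonomials (Fin q) (ZMod 2)).constr_basis (ZMod 2) (fun e =>
    if ∀ i, Odd (e i) then (monomial (e.mapRange (· / 2) rfl) 1 : PolyAlg q) else 0) e
  rwa [coe_basisMonomials] at this

theorem mulSq_xs_monomial (s : Finset (Fin q)) (e : Fin q →₀ ℕ) :
    mulSq (xs s) (monomial e 1) =
      monomial ((∑ j ∈ s, Finsupp.single j 1) + 2 • e) 1 := by
  rw [mulSq_apply, monomial_sq, xs]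
  simp_rw [X]
  rw [← monomial_sum_one, monomial_mul, one_mul]

theorem kameko_mulSq (s : Finset (Fin q)) (y : PolyAlg q) :
    kameko q (mulSq (xs s) y) = if s = Finset.univ then y else 0 := by
  have h := map_mem_of_monomial ((kameko q).comp (mulSq (xs s)) -
    if s = Finset.univ then LinearMap.id else 0) ⊥ (fun e => ?_) y
  · rw [Submodule.mem_bot, LinearMap.sub_apply, sub_eq_zero] at h
    rw [← LinearMap.comp_apply, h]
    split_ifs <;> rfl
  · rw [Submodule.mem_bot, LinearMap.sub_apply, sub_eq_zero, LinearMap.comp_apply,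
      mulSq_xs_monomial, kameko_monomial]
    have hval : ∀ i, ((∑ j ∈ s, Finsupp.single j 1) + 2 • e : Fin q →₀ ℕ) i =
        (if i ∈ s then 1 else 0) + 2 * e i := by
      intro i
      simp [Finsupp.single_apply]
    by_cases hs : s = Finset.univ
    · rw [if_pos hs, if_pos, LinearMap.id_apply]
      · refine congrArg (fun c => monomial c (1 : ZMod 2)) (Finsupp.ext fun i => ?_)
        rw [Finsupp.mapRange_apply, hval, hs, if_pos (Finset.mem_univ i)]
        omega
      · intro i
        rw [hval, hs, if_pos (Finset.mem_univ i)]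
        exact ⟨e i, by omega⟩
    · rw [if_neg hs, if_neg, LinearMap.zero_apply]
      intro h
      refine hs (Finset.eq_univ_iff_forall.2 fun i => ?_)
      by_contra hi
      have := h i
      rw [hval, if_neg hi, zero_add] at this
      exact (Nat.not_odd_iff_even.2 (even_two_mul _)) this

/-- `sq` can only shrink the set of odd exponents, so all exponents are odd in a term only if they
were odd before. -/
theorem kameko_sq (f : PolyAlg q) : kameko q (sq q f) = sq q (kameko q f) := by
  have h := map_mem_of_monomial ((kameko q).comp (sq q).toLinearMap -
    (sq q).toLinearMap.comp (kameko q)) ⊥ (fun e => ?_) f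
  · rw [Submodule.mem_bot, LinearMap.sub_apply, sub_eq_zero] at h
    exact h
  · obtain ⟨s, e', he⟩ := monomial_eq_mulSq e
    rw [he, Submodule.mem_bot, LinearMap.sub_apply, sub_eq_zero, LinearMap.comp_apply,
      LinearMap.comp_apply, AlgHom.toLinearMap_apply, AlgHom.toLinearMap_apply, sq_mulSq_xs, map_sum]
    simp_rw [kameko_mulSq]
    split_ifs with hs
    · subst hs
      rw [Finset.sum_ite_eq' ]
      simp [xs]
    · rw [map_zero]
      refine Finset.sum_eq_zero fun t ht => if_neg ?_
      rintro rfl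
      exact hs (Finset.univ_subset_iff.1 (Finset.mem_powerset.1 ht))

theorem kameko_mem_hitIn {N M : ℕ} (h : N = 2 * M + q) {f : PolyAlg q} (hf : f ∈ hitIn q N) :
    kameko q f ∈ hitIn q M := by
  refine map_mem_of_hitIn (kameko q) _ (fun g => ?_) (fun e he => ?_) hf
  · rw [map_sub, kameko_sq]
    exact sq_sub_mem_hitIn M _
  · obtain ⟨s, e', hs⟩ := monomial_eq_mulSq e
    have h1 : e.degree = s.card + 2 * e'.degree := by
      have h2 := mulSq_xs_monomial_mem s e'
      rw [← hs] at h2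
      exact h2 e (by simp)
    rw [hs, kameko_mulSq]
    split_ifs with h'
    · rw [h', Finset.card_univ, Fintype.card_fin] at h1
      exact degIn_le_hitIn (A := {e'.degree}) (by rw [Set.mem_singleton_iff]; omega)
        (monomial_mem_degIn 1 rfl)
    · exact zero_mem _

theorem xs_univ_erase_self (p : Fin (q + 1)) :
    xs (Finset.univ.erase p) = ∏ i, (X (p.succAbove i) : PolyAlg (q + 1)) := by
  rw [xs, Fin.univ_succAbove _ p, Finset.erase_cons, Finset.prod_map]
  rfl

theorem xs_univ_erase_succAbove (p : Fin (q + 1)) (j : Fin q) :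
    xs (Finset.univ.erase (p.succAbove j)) =
      X p * ∏ i ∈ Finset.univ.erase j, (X (p.succAbove i) : PolyAlg (q + 1)) := by
  have h : Finset.univ.erase (p.succAbove j) =
      insert p ((Finset.univ.erase j).map p.succAboveEmb) := by
    ext i
    rcases Fin.eq_self_or_eq_succAbove p i with rfl | ⟨i, rfl⟩
    · simp [(Fin.succAbove_ne _ j).symm]
    · simp [Fin.succAbove_ne]
  rw [xs, h, Finset.prod_insert, Finset.prod_map]
  · rfl
  · simp [Fin.succAbove_ne]

/-- For j = p the restricted product is that of all q variables. Otherwise x_p becomes the sum of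
the other x_i with i in L, and only the summand x_j completes the product. -/
theorem kameko_proj_lift {p : Fin (q + 1)} {L : Finset (Fin (q + 1))} (hp : p ∈ L)
    (j : Fin (q + 1)) (y : PolyAlg (q + 1)) :
    kameko q (proj p L (lift j y)) = if j ∈ L then proj p L y else 0 := by
  rw [lift_apply, map_mul, map_pow]
  rcases Fin.eq_self_or_eq_succAbove p j with rfl | ⟨j, rfl⟩
  · rw [xs_univ_erase_self, map_prod, if_pos hp]
    simp_rw [proj_X_succAbove]
    have := kameko_mulSq Finset.univ (proj j L y)
    rwa [if_pos rfl] at this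
  · rw [xs_univ_erase_succAbove, map_mul (proj p L), map_prod, proj_X_self]
    simp_rw [proj_X_succAbove]
    rw [← xs, form, Finset.sum_mul, Finset.sum_mul, map_sum]
    have hi : ∀ i, kameko q (X i * xs (Finset.univ.erase j) * proj p L y ^ 2) =
        if i = j then proj p L y else 0 := by
      intro i
      split_ifs with hij
      · subst hij
        rw [X_mul_xs_erase (Finset.mem_univ i), ← mulSq_apply, kameko_mulSq, if_pos rfl]
      · have hm : i ∈ Finset.univ.erase j := by simp [hij]
        rw [X_mul_xs hm, mul_assoc, ← mul_pow, ← mulSq_apply, kameko_mulSq, if_neg]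
        intro h
        have := h ▸ Finset.mem_univ i
        simp at this
    simp_rw [hi]
    rw [Finset.sum_ite_eq']
    simp

theorem kameko_pow_proj_lifts {p : Fin (q + 1)} {L : Finset (Fin (q + 1))} (hp : p ∈ L)
    (J : List (Fin (q + 1))) (y : PolyAlg (q + 1)) :
    (kameko q ^ J.length) (proj p L (lifts J y)) = if J.toFinset ⊆ L then proj p L y else 0 := by
  induction J with
  | nil => simp
  | cons j J ih =>
    rw [List.length_cons, pow_succ, Module.End.mul_apply, lifts_cons, kameko_proj_lift hp]
    by_cases h : j ∈ L
    · simp [h, ih, Finset.insert_subset_iff]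
    · simp [h, Finset.insert_subset_iff]

theorem kameko_pow_proj_setLift {d : ℕ} {p : Fin (q + 1)} {L : Finset (Fin (q + 1))} (hp : p ∈ L)
    {S : Finset (Fin (q + 1))} (hS : S.Nonempty ∧ S.card ≤ d) (y : PolyAlg (q + 1)) :
    (kameko q ^ d) (proj p L (setLift d S y)) = if S ⊆ L then proj p L y else 0 := by
  obtain ⟨J, rfl, rfl, h3⟩ := exists_setLift_eq hS
  rw [h3, kameko_pow_proj_lifts hp]

theorem Chain.kameko_pow_mem {d N M : ℕ} (hc : Chain (q + 1) d N M) {f : PolyAlg q}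
    (hf : f ∈ hitIn q N) : (kameko q ^ d) f ∈ hitIn q M := by
  induction d generalizing N f with
  | zero => exact (show N = M from hc) ▸ hf
  | succ d ih =>
    obtain ⟨N', h1, h2⟩ := hc
    rw [pow_succ, Module.End.mul_apply]
    have := h1.eq
    exact ih h2 (kameko_mem_hitIn (by omega) hf)

end HitProblem

/-! ### The isomorphism with 2^k - 1 copies -/

namespace HitProblem

open MvPolynomial

theorem sum_eq_sum_relSum {k M : ℕ} {V : Type*} [AddCommGroup V] [Module (ZMod 2) V]
    (e : Finset (Fin k) → PolyAlg k →ₗ[ZMod 2] V)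
    (he0 : ∀ S, ∀ y ∈ hitIn k M, e S y = 0) {y u : Finset (Fin k) → PolyAlg k}
    (hu : ∀ L, ∑ S with S ⊆ L, y S - form L * u L ∈ hitIn k M) :
    ∑ S, e S (y S) = ∑ L, upSum e L (form L * u L) := by
  rw [sum_eq_sum_upSum]
  refine Finset.sum_congr rfl fun L _ => ?_
  rw [← sub_eq_zero, ← map_sub]
  exact upSum_eq_zero e he0 L (hu L)

/-- By inversion the sum is a sum of `upSum` at ℓ_L u_L, hence of relation sums at complements of
points. For d ≥ k these vanish. For d = k - 1 they combine to σ(∑ ℓ_L u_L), with σ from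
`exists_section`, so it remains to see that ∑ ℓ_L u_L is hit. -/
theorem Chain.sum_setLift_mem {k d N M : ℕ} (hc : Chain k d N M) (hd : k ≤ d + 1)
    {y u : Finset (Fin k) → PolyAlg k} (hy : ∀ S, ¬(S.Nonempty ∧ S.card ≤ d) → y S = 0)
    (hu : ∀ L, ∑ S with S ⊆ L, y S - form L * u L ∈ hitIn k M) :
    ∑ S, setLift d S (y S) ∈ hitIn k N := by
  rcases hd.eq_or_lt with hd | hd
  -- The second component is an auxiliary copy of degree M placed at the full set. The relations
  -- with |T| ≤ k - 2 never reach that set, so they persist.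
  · let e : Finset (Fin k) → PolyAlg k →ₗ[ZMod 2]
        (PolyAlg k ⧸ hitIn k N) × (PolyAlg k ⧸ hitIn k M) := fun S =>
      LinearMap.prod ((hitIn k N).mkQ.comp (setLift d S))
        (if S = Finset.univ then (hitIn k M).mkQ else 0)
    have hfst : ∀ S y, (e S y).1 = (hitIn k N).mkQ (setLift d S y) := fun S y => rfl
    have hsnd : ∀ S y, (e S y).2 = if S = Finset.univ then (hitIn k M).mkQ y else 0 := by
      intro S y
      simp only [e]
      split_ifs <;> rfl
    clear_value e
    have he0 : ∀ S, ∀ y ∈ hitIn k M, e S y = 0 := by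
      intro S y hy
      refine Prod.ext ?_ ?_
      · rw [hfst]
        exact (Submodule.Quotient.mk_eq_zero _).2 (hc.setLift_mem S hy)
      · rw [hsnd]
        split_ifs
        · exact (Submodule.Quotient.mk_eq_zero _).2 hy
        · rfl
    have he : ∀ T, T.card + 2 ≤ k → relSum e T = 0 := by
      intro T hT
      refine LinearMap.ext fun g => Prod.ext ?_ ?_
      · rw [relSum_apply, Prod.fst_sum]
        simp_rw [hfst]
        rw [← map_sum]
        exact (Submodule.Quotient.mk_eq_zero _).2 (hc.relation (by omega) g)
      · rw [relSum_apply, Prod.snd_sum]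
        refine Finset.sum_eq_zero fun j _ => ?_
        rw [hsnd, if_neg]
        intro h
        have h1 := Finset.card_insert_le j T
        rw [h, Finset.card_univ, Fintype.card_fin] at h1
        omega
    obtain ⟨σ, h1, h2⟩ := exists_section e he0 he
    have h3 := sum_eq_sum_relSum e he0 hu
    -- In the second component the inversion formula reads y_univ = ∑ ℓ_L u_L modulo hits, and
    -- y_univ = 0 since the full set has k > d elements.
    have h4 : ∑ L, form L * u L ∈ hitIn k M := by
      have h5 := congrArg Prod.snd h3
      rw [Prod.snd_sum, Prod.snd_sum] at h5
      simp_rw [upSum_apply, Prod.snd_sum, hsnd] at h5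
      rw [← Submodule.Quotient.mk_eq_zero, ← Submodule.mkQ_apply, map_sum]
      rw [Finset.sum_ite_eq', hy Finset.univ] at h5
      · rw [map_zero] at h5
        simp only [Finset.mem_univ, if_true] at h5
        rw [h5]
        refine Finset.sum_congr rfl fun L _ => ?_
        rw [Finset.sum_ite_eq', if_pos (by simp)]
      · rw [Finset.card_univ, Fintype.card_fin]
        omega
    have h6 : ∑ S, e S (y S) = 0 := by
      rw [h3, ← h2 _ h4, map_sum]
      refine Finset.sum_congr rfl fun L _ => ?_
      rw [upSum_form_mul_eq e he, form, Finset.sum_mul, map_sum]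
      simp_rw [h1]
    have h7 := congrArg Prod.fst h6
    rw [Prod.fst_sum] at h7
    simp_rw [hfst] at h7
    rw [← map_sum] at h7
    exact (Submodule.Quotient.mk_eq_zero _).1 h7
  · have he0 : ∀ S, ∀ y ∈ hitIn k M, (hitIn k N).mkQ.comp (setLift d S) y = 0 := fun S y hy =>
      (Submodule.Quotient.mk_eq_zero _).2 (hc.setLift_mem S hy)
    have he : ∀ T : Finset (Fin k), T.card < d →
        relSum (fun S => (hitIn k N).mkQ.comp (setLift d S)) T = 0 := by
      intro T hT
      refine LinearMap.ext fun g => ?_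
      rw [relSum_apply]
      simp_rw [LinearMap.comp_apply]
      rw [← map_sum]
      exact (Submodule.Quotient.mk_eq_zero _).2 (hc.relation hT g)
    have h3 := sum_eq_sum_relSum _ he0 hu
    simp_rw [LinearMap.comp_apply] at h3
    rw [← map_sum] at h3
    refine (Submodule.Quotient.mk_eq_zero _).1 (h3.trans ?_)
    refine Finset.sum_eq_zero fun L _ => ?_
    rw [upSum_form_mul_eq _ fun T hT => he T (by omega)]
    refine Finset.sum_eq_zero fun i _ => ?_
    have := card_erase_univ i
    rw [he _ (by omega), LinearMap.zero_apply]

variable {q d N M : ℕ}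

/-- Restriction to the hyperplane `form L = 0`, followed by the `d`-fold Kameko map. -/
noncomputable def descent (d : ℕ) (L : {L : Finset (Fin (q + 1)) // L.Nonempty}) :
    PolyAlg (q + 1) →ₗ[ZMod 2] PolyAlg q :=
  (kameko q ^ d).comp (proj L.2.choose L.1).toLinearMap

theorem descent_setLift (L : {L : Finset (Fin (q + 1)) // L.Nonempty})
    {S : Finset (Fin (q + 1))} (hS : S.Nonempty ∧ S.card ≤ d) (y : PolyAlg (q + 1)) :
    descent d L (setLift d S y) = if S ⊆ L.1 then proj L.2.choose L.1 y else 0 :=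
  kameko_pow_proj_setLift L.2.choose_spec hS y

theorem Chain.descent_mem (hc : Chain (q + 1) d N M)
    (L : {L : Finset (Fin (q + 1)) // L.Nonempty}) {f : PolyAlg (q + 1)}
    (hf : f ∈ hitIn (q + 1) N) : descent d L f ∈ hitIn q M :=
  hc.kameko_pow_mem (proj_mem_hitIn _ _ hf)

theorem Chain.mem_of_descent_mem (hc : Chain (q + 1) d N M) (hd : q ≤ d) (hd0 : 0 < d)
    {f : PolyAlg (q + 1)} (hf : ∀ L, descent d L f ∈ hitIn q M) : f ∈ hitIn (q + 1) N := by
  obtain ⟨y, hy, hfy⟩ := hc.exists_sum_setLift hd0 f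
  have hu : ∀ L, ∃ u, ∑ S with S ⊆ L, y S - form L * u ∈ hitIn (q + 1) M := by
    intro L
    by_cases hL : L.Nonempty
    · refine exists_sub_form_mul_mem hL.choose_spec ?_
      have h1 := sub_mem (hf ⟨L, hL⟩) (hc.descent_mem ⟨L, hL⟩ hfy)
      rw [map_sub, sub_sub_cancel, map_sum] at h1
      convert h1 using 1
      rw [map_sum, Finset.sum_filter]
      refine Finset.sum_congr rfl fun S _ => ?_
      by_cases hS : S.Nonempty ∧ S.card ≤ d
      · exact (descent_setLift ⟨L, hL⟩ hS (y S)).symm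
      · rw [hy S hS, map_zero, map_zero, map_zero, ite_self]
    · rw [Finset.not_nonempty_iff_eq_empty] at hL
      subst hL
      refine ⟨0, ?_⟩
      have : (∑ S with S ⊆ (∅ : Finset (Fin (q + 1))), y S) = 0 := by
        refine Finset.sum_eq_zero fun S hS => hy S fun h => ?_
        rw [Finset.mem_filter, Finset.subset_empty] at hS
        exact h.1.ne_empty hS.2
      rw [this, mul_zero, sub_zero]
      exact zero_mem _
  choose u hu using hu
  have := add_mem hfy (hc.sum_setLift_mem (by omega) hy hu)
  rwa [sub_add_cancel] at this

/-- The product of the maps `descent d L`, with values modulo hit polynomials. -/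
noncomputable def descentPi (d M : ℕ) : PolyAlg (q + 1) →ₗ[ZMod 2]
    ({L : Finset (Fin (q + 1)) // L.Nonempty} → PolyAlg q ⧸ hitIn q M) :=
  LinearMap.pi fun L => (hitIn q M).mkQ.comp (descent d L)

theorem Chain.ker_descentPi (hc : Chain (q + 1) d N M) (hd : q ≤ d) (hd0 : 0 < d) :
    LinearMap.ker (descentPi (q := q) d M) = hitIn (q + 1) N := by
  ext f
  rw [LinearMap.mem_ker]
  constructor
  · intro h
    exact hc.mem_of_descent_mem hd hd0 fun L =>
      (Submodule.Quotient.mk_eq_zero _).1 (congrFun h L)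
  · intro h
    exact funext fun L => (Submodule.Quotient.mk_eq_zero _).2 (hc.descent_mem L h)

/-- The number of S between L and L' is odd only for L = L'. Excluding the full set, unavailable
when d = q, costs an error at L' = univ. -/
theorem descent_sum_proper (hd : q ≤ d) (L L' : {L : Finset (Fin (q + 1)) // L.Nonempty})
    (y : PolyAlg (q + 1)) :
    descent d L' (∑ S with L.1 ⊆ S ∧ S ≠ Finset.univ, setLift d S y) =
      (if L = L' then proj L'.2.choose L'.1 y else 0) +
        if L'.1 = Finset.univ then proj L'.2.choose L'.1 y else 0 := by
  have h0 : ∀ S ∈ Finset.univ.filter (fun S => L.1 ⊆ S ∧ S ≠ Finset.univ),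
      descent d L' (setLift d S y) = if S ⊆ L'.1 then proj L'.2.choose L'.1 y else 0 := by
    intro S hS
    rw [Finset.mem_filter] at hS
    refine descent_setLift L' ⟨L.2.mono hS.2.1, ?_⟩ y
    have h5 := Finset.card_lt_card (Finset.ssubset_univ_iff.2 hS.2.2)
    rw [Finset.card_univ, Fintype.card_fin] at h5
    omega
  have h1 := sum_between L.1 L'.1 (proj L'.2.choose L'.1 y)
  rw [map_sum, Finset.sum_congr rfl h0]
  simp_rw [Subtype.ext_iff]
  generalize proj L'.2.choose L'.1 y = v at h1 ⊢
  rw [← h1, ← Finset.sum_filter, Finset.filter_filter]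
  by_cases hL : L'.1 = Finset.univ
  · rw [if_pos hL, hL]
    have h2 : Finset.univ.filter (fun S => L.1 ⊆ S ∧ S ⊆ Finset.univ) =
        insert Finset.univ
          (Finset.univ.filter fun S => (L.1 ⊆ S ∧ S ≠ Finset.univ) ∧ S ⊆ Finset.univ) := by
      ext S
      by_cases hS : S = Finset.univ
      · simp [hS]
      · simp [hS]
    rw [h2, Finset.sum_insert (by simp), add_right_comm, add_self_eq_zero', zero_add]
  · rw [if_neg hL, add_zero]
    refine Finset.sum_congr ?_ fun _ _ => rfl
    ext S
    simp only [Finset.mem_filter, Finset.mem_univ, true_and]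
    constructor
    · rintro ⟨⟨h2, -⟩, h3⟩
      exact ⟨h2, h3⟩
    · rintro ⟨h2, h3⟩
      exact ⟨⟨h2, fun h => hL (Finset.univ_subset_iff.1 (h ▸ h3))⟩, h3⟩

theorem range_descentPi (hd : q ≤ d) (hM : 0 < M) :
    LinearMap.range (descentPi (q := q) d M) = ⊤ := by
  classical
  have key : ∀ L (z : PolyAlg q), Pi.single L ((hitIn q M).mkQ z) ∈
      LinearMap.range (descentPi (q := q) d M) := by
    intro L z
    refine map_mem_of_monomial
      ((LinearMap.single (ZMod 2) (fun _ => PolyAlg q ⧸ hitIn q M) L).comp (hitIn q M).mkQ)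
      _ (fun c => ?_) z
    rw [LinearMap.comp_apply, LinearMap.single_apply]
    by_cases hc : c.degree = M
    swap
    · have : (hitIn q M).mkQ (monomial c 1) = 0 := (Submodule.Quotient.mk_eq_zero _).2
        (degIn_le_hitIn (A := {c.degree}) (fun h => hc h.symm) (monomial_mem_degIn 1 rfl))
      rw [this, Pi.single_zero]
      exact zero_mem _
    induction c using exponent_induction with
    | h0 => simp at hc; omega
    | hs c i _ =>
      rw [monomial_single_add]
      set z := X i * monomial c (1 : ZMod 2) with hz
      set p := L.2.choose with hp
      have hpL : p ∈ L.1 := L.2.choose_spec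
      -- The same sum for this singleton cancels the error at the full set. Its own contribution
      -- vanishes because the included monomial is divisible by the variable killed on that
      -- hyperplane. Such a variable exists because M > 0.
      let L₁ : {L : Finset (Fin (q + 1)) // L.Nonempty} :=
        ⟨{p.succAbove i}, Finset.singleton_nonempty _⟩
      have hL₁ : L ≠ L₁ := by
        rintro h
        rw [h] at hpL
        exact Fin.succAbove_ne p i (Finset.mem_singleton.1 hpL).symm
      have hpiv : L₁.2.choose = p.succAbove i := Finset.mem_singleton.1 L₁.2.choose_spec
      have h0 : proj L₁.2.choose L₁.1 (incl p z) = 0 := by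
        rw [hz, map_mul, map_mul, incl_X, ← hpiv, proj_X_self]
        have : (Finset.univ.filter fun j => L₁.2.choose.succAbove j ∈ L₁.1) = ∅ := by
          refine Finset.filter_eq_empty_iff.2 fun j _ h => ?_
          exact Fin.succAbove_ne _ j ((Finset.mem_singleton.1 h).trans hpiv.symm)
        rw [this, form, Finset.sum_empty, zero_mul]
      refine ⟨∑ S with L.1 ⊆ S ∧ S ≠ Finset.univ, setLift d S (incl p z) +
        ∑ S with L₁.1 ⊆ S ∧ S ≠ Finset.univ, setLift d S (incl p z), funext fun L' => ?_⟩
      change (hitIn q M).mkQ (descent d L' _) = _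
      rw [map_add, descent_sum_proper hd, descent_sum_proper hd, add_add_add_comm,
        add_self_eq_zero', add_zero]
      by_cases h1 : L₁ = L'
      · rw [← h1, if_neg hL₁, if_pos rfl, h0, Pi.single_eq_of_ne hL₁.symm, add_zero, map_zero]
      · rw [if_neg h1, add_zero]
        by_cases h2 : L = L'
        · rw [← h2, if_pos rfl, Pi.single_eq_same, ← hp, proj_incl]
        · rw [if_neg h2, map_zero, Pi.single_eq_of_ne (Ne.symm h2)]
  rw [eq_top_iff]
  intro x _
  rw [← Finset.univ_sum_single x]
  refine Submodule.sum_mem _ fun L _ => ?_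
  obtain ⟨z, hz⟩ := (hitIn q M).mkQ_surjective (x L)
  rw [← hz]
  exact key L z

theorem card_nonempty_finset (k : ℕ) :
    Fintype.card {L : Finset (Fin k) // L.Nonempty} = 2 ^ k - 1 := by
  rw [Fintype.card_subtype]
  have h : (Finset.univ.filter fun L : Finset (Fin k) => L.Nonempty) = Finset.univ.erase ∅ := by
    ext L
    simp [Finset.nonempty_iff_ne_empty]
  rw [h, Finset.card_erase_of_mem (Finset.mem_univ _), Finset.card_univ, Fintype.card_finset,
    Fintype.card_fin]

theorem Chain.finrank_eq (hc : Chain (q + 1) d N M) (hd : q ≤ d) (hd0 : 0 < d) (hM : 0 < M) :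
    Module.finrank (ZMod 2) (QPdeg (q + 1) N) =
      (2 ^ (q + 1) - 1) * Module.finrank (ZMod 2) (QPdeg q M) := by
  rw [← (quotHitInEquiv (q + 1) N).finrank_eq, ← (quotHitInEquiv q M).finrank_eq,
    (Submodule.quotEquivOfEq _ _ (hc.ker_descentPi hd hd0).symm).finrank_eq,
    ((descentPi d M).quotKerEquivOfSurjective
      (LinearMap.range_eq_top.1 (range_descentPi hd hM))).finrank_eq,
    Module.finrank_pi_fintype, Finset.sum_const, Finset.card_univ, card_nonempty_finset, smul_eq_mul]

end HitProblem

/-! ### Binary digit sums and the chain of degrees -/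

namespace HitProblem

/-- The binary digit sum. -/
def digitSum (n : ℕ) : ℕ := (Nat.digits 2 n).sum

theorem digitSum_eq (n : ℕ) : digitSum n = n % 2 + digitSum (n / 2) := by
  rcases Nat.eq_zero_or_pos n with rfl | h
  · simp [digitSum]
  · rw [digitSum, Nat.digits_def' one_lt_two h, List.sum_cons, digitSum]

theorem digitSum_succ_le (n : ℕ) : digitSum (n + 1) ≤ digitSum n + 1 := by
  induction n using Nat.strong_induction_on with
  | _ n ih =>
    rw [digitSum_eq (n + 1), digitSum_eq n]
    rcases Nat.mod_two_eq_zero_or_one n with h | h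
    · rw [show (n + 1) / 2 = n / 2 by omega]
      omega
    · rw [show (n + 1) / 2 = n / 2 + 1 by omega]
      have := ih (n / 2) (by omega)
      omega

theorem digitSum_add_le (n c : ℕ) : digitSum (n + c) ≤ digitSum n + c := by
  induction c with
  | zero => rfl
  | succ c ih =>
    have := digitSum_succ_le (n + c)
    rw [← add_assoc]
    omega

theorem digitSum_two_pow_add_le (n a : ℕ) : digitSum (2 ^ a + n) ≤ digitSum n + 1 := by
  induction a generalizing n with
  | zero => rw [pow_zero, add_comm]; exact digitSum_succ_le n
  | succ a ih =>
    rw [digitSum_eq (2 ^ (a + 1) + n), digitSum_eq n, pow_succ,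
      show (2 ^ a * 2 + n) / 2 = 2 ^ a + n / 2 by omega]
    have := ih (n / 2)
    omega

theorem digitSum_sum_two_pow_le {ι : Type*} (s : Finset ι) (a : ι → ℕ) :
    digitSum (∑ j ∈ s, 2 ^ a j) ≤ s.card := by
  classical
  induction s using Finset.induction_on with
  | empty => simp [digitSum]
  | insert j s hj ih =>
    rw [Finset.sum_insert hj, Finset.card_insert_of_notMem hj]
    have := digitSum_two_pow_add_le (∑ j ∈ s, 2 ^ a j) (a j)
    omega

theorem digitSum_two_pow_add {x b : ℕ} (h : x < 2 ^ b) :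
    digitSum (2 ^ b + x) = digitSum x + 1 := by
  induction b generalizing x with
  | zero =>
    obtain rfl : x = 0 := by simpa using h
    simp [digitSum]
  | succ b ih =>
    rw [pow_succ] at h ⊢
    rw [digitSum_eq (2 ^ b * 2 + x), digitSum_eq x,
      show (2 ^ b * 2 + x) / 2 = 2 ^ b + x / 2 by omega, ih (by omega)]
    omega

theorem digitSum_two_pow_sub_one (c : ℕ) : digitSum (2 ^ c - 1) = c := by
  induction c with
  | zero => simp [digitSum]
  | succ c ih =>
    have := Nat.one_le_two_pow (n := c)
    rw [pow_succ, show 2 ^ c * 2 - 1 = 2 ^ c + (2 ^ c - 1) by omega,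
      digitSum_two_pow_add (by omega), ih]

theorem digitSum_sum_two_pow_add {e : ℕ → ℕ} (l : ℕ) {x : ℕ}
    (he : ∀ i, 1 ≤ i → i < l → e (i + 1) < e i) (hx : l ≠ 0 → x < 2 ^ e l) :
    digitSum (∑ i ∈ Finset.Icc 1 l, 2 ^ e i + x) = l + digitSum x := by
  induction l generalizing x with
  | zero => simp
  | succ l ih =>
    have hx' := hx (Nat.succ_ne_zero l)
    rw [Finset.sum_Icc_succ_top (by omega), add_assoc, ih (fun i h1 h2 => he i h1 (by omega)),
      digitSum_two_pow_add hx']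
    · omega
    · intro hl
      have h1 := Nat.pow_le_pow_right (n := 2) two_pos (he l (by omega) (by omega))
      rw [pow_succ] at h1
      omega

/-- Subtracting 1 turns the lowest power 2^c into c ones. If the last two exponents agree, they
first merge into a power with exponent e_r + 1 ≥ 2, which makes up for the lost summand. -/
theorem le_digitSum_sum_sub_one {e : ℕ → ℕ} {r : ℕ} (hr : 2 ≤ r)
    (he : ∀ i, 1 ≤ i → i < r - 1 → e (i + 1) < e i) (hl : e r ≤ e (r - 1)) (h1 : 1 ≤ e r) :
    r ≤ digitSum (∑ i ∈ Finset.Icc 1 r, 2 ^ e i - 1) := by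
  obtain ⟨l, rfl⟩ := Nat.exists_eq_add_of_le' hr
  rw [show l + 2 - 1 = l + 1 by omega] at he hl
  have hp := Nat.one_le_two_pow (n := e (l + 2))
  rcases hl.eq_or_lt with h | h
  · rw [Finset.sum_Icc_succ_top (by omega), Finset.sum_Icc_succ_top (by omega), ← h,
      show ∀ A, A + 2 ^ e (l + 2) + 2 ^ e (l + 1 + 1) - 1 = A + (2 ^ (e (l + 2) + 1) - 1) by
        intro A; rw [pow_succ, show l + 1 + 1 = l + 2 from rfl]; omega,
      digitSum_sum_two_pow_add l (fun i h1 h2 => he i h1 (by omega)), digitSum_two_pow_sub_one]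
    · omega
    · intro hl0
      have h2 := he l (by omega) (by omega)
      have h3 := Nat.pow_le_pow_right (n := 2) two_pos h2
      rw [← h] at h3
      have := Nat.one_le_two_pow (n := e (l + 2) + 1)
      rw [Nat.succ_eq_add_one] at h3
      omega
  · rw [Finset.sum_Icc_succ_top (by omega), Nat.add_sub_assoc hp,
      digitSum_sum_two_pow_add (l + 1) he, digitSum_two_pow_sub_one]
    · rw [show l + 1 + 1 = l + 2 from rfl]
      omega
    · intro _
      have := Nat.pow_le_pow_right (n := 2) two_pos h.le
      rw [show l + 1 + 1 = l + 2 from rfl]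
      omega

theorem sum_two_pow_sub_one_add (s : Finset ℕ) (e : ℕ → ℕ) :
    ∑ i ∈ s, (2 ^ e i - 1) + s.card = ∑ i ∈ s, 2 ^ e i := by
  rw [Finset.card_eq_sum_ones, ← Finset.sum_add_distrib]
  exact Finset.sum_congr rfl fun i _ => Nat.sub_add_cancel Nat.one_le_two_pow

/-- If N + |s| were a sum of |s| powers of two, adding r - |s| - 1 would give ∑ 2^(e_i) - 1 a digit
sum of at most r - 1, against `le_digitSum_sum_sub_one`. -/
theorem good_sum {e : ℕ → ℕ} {r : ℕ} (hr : 2 ≤ r)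
    (he : ∀ i, 1 ≤ i → i < r - 1 → e (i + 1) < e i) (hl : e r ≤ e (r - 1)) (h1 : 1 ≤ e r) :
    Good (r + 1) (∑ i ∈ Finset.Icc 1 r, (2 ^ e i - 1)) := by
  refine good_of_ne fun s hs a heq => ?_
  have h2 := le_digitSum_sum_sub_one hr he hl h1
  have h3 := sum_two_pow_sub_one_add (Finset.Icc 1 r) e
  rw [Nat.card_Icc, Nat.add_sub_cancel] at h3
  have h4 := digitSum_add_le (∑ j ∈ s, 2 ^ (a j + 1)) (r - s.card - 1)
  have h5 := digitSum_sum_two_pow_le s fun j => a j + 1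
  rw [show ∑ j ∈ s, 2 ^ (a j + 1) + (r - s.card - 1) = ∑ i ∈ Finset.Icc 1 r, 2 ^ e i - 1 by omega]
    at h4
  omega

theorem le_of_descending {d : ℕ → ℕ} {r : ℕ} (he : ∀ i, 1 ≤ i → i < r - 1 → d (i + 1) < d i)
    (hl : d r ≤ d (r - 1)) {i : ℕ} (hi : i ∈ Finset.Icc 1 r) : d r ≤ d i := by
  rw [Finset.mem_Icc] at hi
  obtain ⟨c, hc⟩ := Nat.exists_eq_add_of_le hi.2
  induction c generalizing i with
  | zero => rw [hc, add_zero]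
  | succ c ih =>
    have h1 := ih (i := i + 1) (by omega) (by omega)
    rcases Nat.lt_or_ge i (r - 1) with h | h
    · exact h1.trans (he i hi.1 h).le
    · obtain rfl : i = r - 1 := by omega
      exact hl

theorem chain_sum {d : ℕ → ℕ} {r : ℕ} (hr : 2 ≤ r)
    (he : ∀ i, 1 ≤ i → i < r - 1 → d (i + 1) < d i) (hl : d r ≤ d (r - 1)) (c t : ℕ)
    (hc : t + c ≤ d r) :
    Chain (r + 1) c (∑ i ∈ Finset.Icc 1 r, (2 ^ (d i - t) - 1))
      (∑ i ∈ Finset.Icc 1 r, (2 ^ (d i - (t + c)) - 1)) := by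
  induction c generalizing t with
  | zero => rfl
  | succ c ih =>
    refine ⟨_, ⟨?_, ?_⟩, by simpa [add_assoc, add_comm 1] using ih (t + 1) (by omega)⟩
    · have h : ∑ i ∈ Finset.Icc 1 r, (2 ^ (d i - t) - 1) =
          ∑ i ∈ Finset.Icc 1 r, (2 * (2 ^ (d i - (t + 1)) - 1) + 1) := by
        refine Finset.sum_congr rfl fun i hi => ?_
        have h1 := le_of_descending he hl hi
        rw [show d i - t = d i - (t + 1) + 1 by omega, pow_succ]
        have := Nat.one_le_two_pow (n := d i - (t + 1))
        omega
      rw [h, Finset.sum_add_distrib, ← Finset.mul_sum, Finset.sum_const, Nat.card_Icc, smul_eq_mul,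
        mul_one, Nat.add_sub_cancel, add_assoc]
    · have hle : ∀ i, 1 ≤ i → i ≤ r → d r ≤ d i := fun i h1 h2 =>
        le_of_descending he hl (Finset.mem_Icc.2 ⟨h1, h2⟩)
      refine good_sum hr (fun i h1 h2 => ?_) (Nat.sub_le_sub_right hl t) (by omega)
      have h3 := he i h1 h2
      have h4 := hle (i + 1) (by omega) (by omega)
      omega

end HitProblem

/-! ### The theorem -/

theorem theorem1p3 (k : ℕ) (d : ℕ → ℕ) (n m : ℕ)
    (hd_pos : ∀ i ∈ Finset.Icc 1 (k - 1), 0 < d i)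
    (hd_strict : ∀ i, 1 ≤ i → i < k - 2 → d (i + 1) < d i)
    (hd_last : d (k - 1) ≤ d (k - 2))
    (hn : n = ∑ i ∈ Finset.Icc 1 (k - 1), (2 ^ d i - 1))
    (hm : m = ∑ i ∈ Finset.Icc 1 (k - 2), (2 ^ (d i - d (k - 1)) - 1))
    (hk : 3 ≤ k - 1) (hdk : k - 1 ≤ d (k - 1)) :
    Module.finrank (ZMod 2) (QPdeg k n) =
      (2 ^ k - 1) * Module.finrank (ZMod 2) (QPdeg (k - 1) m) := by
  obtain ⟨q, rfl⟩ : ∃ q, k = q + 1 := ⟨k - 1, by omega⟩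
  rw [show q + 1 - 2 = q - 1 by omega] at hd_strict hd_last hm
  rw [Nat.add_sub_cancel] at *
  have hc := HitProblem.chain_sum (by omega) hd_strict hd_last (d q) 0 (by omega)
  simp only [Nat.sub_zero, zero_add] at hc
  -- The chain ends at a sum over q terms, whose last is 2^0 - 1 = 0.
  have hm' : ∑ i ∈ Finset.Icc 1 q, (2 ^ (d i - d q) - 1) = m := by
    obtain ⟨l, rfl⟩ : ∃ l, q = l + 1 := ⟨q - 1, by omega⟩
    rw [Finset.sum_Icc_succ_top (by omega), hm]
    simp
  rw [← hn, hm'] at hc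
  -- What remains is m > 0. This uses k - 1 ≥ 3, which gives d_1 > d_2 ≥ d_q.
  refine hc.finrank_eq hdk (by omega) ?_
  rw [← hm']
  have h1 := HitProblem.le_of_descending hd_strict hd_last (i := 2) (by simp; omega)
  have h2 : d 2 < d 1 := hd_strict 1 le_rfl (by omega)
  have h3 : 2 ^ (d 1 - d q) - 1 ≤ ∑ i ∈ Finset.Icc 1 q, (2 ^ (d i - d q) - 1) :=
    Finset.single_le_sum (f := fun i => 2 ^ (d i - d q) - 1) (fun _ _ => Nat.zero_le _)
      (by simp; omega)
  have h4 := Nat.one_lt_two_pow (n := d 1 - d q) (by omega)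
  omega
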